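/- Let $k$ be a field, $Q$ a finite quiver with vertex set $\{1,\dots,n\}$, $I\subseteq kQ$ an admissible ideal generated by a set of paths (of length at least two), and $A=kQ/I$ the corresponding finite-dimensional basic monomial algebra. Products of paths are read from right to left: $e_jAe_i$ is spanned by the paths from $i$ to $j$. A *path in $A$* is a residue class $p+I$ of a path $p\notin I$ of $Q$; let $e_i$ be the class of the trivial path at $i$, $L$ the span of the $e_i$, $P_i=Ae_i$, $L_i=P_i/\operatorname{rad}P_i$, and order the simple modules by $L_i\le L_j\Leftrightarrow i\le j$. Let $\Delta_i$ be the largest factor module of $P_i$ with no composition factor $L_j$, $j>i$, and suppose that $(A,\le)$ is quasi-hereditary, i.e. $A$ has a finite filtration with subquotients among the $\Delta_i$, and $\operatorname{End}_A(\Delta_i)\cong k$ for all $i$. A (unital) subalgebra $B\subseteq A$ is an *exact Borel subalgebra* of $(A,\le)$ if $A\otimes_B-$ is exact on finite-dimensional $B$-modules and there is a bijection $\phi$ from isomorphism classes of simple $B$-modules to those of simple $A$-modules such that, for all simple $B$-modules $S,S'$: $A\otimes_BS\cong\Delta_i$ where $\phi(S)=L_i$; $\operatorname{End}_B(S)\cong\operatorname{End}_A(\phi(S))$;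 and $\operatorname{Ext}^1_B(S,S')\ne0$ implies $\phi(S)\le\phi(S')$. A subalgebra $C\subseteq A$ is a *$\Delta$-subalgebra* if $C^{op}$ is an exact Borel subalgebra of $(A^{op},\le)$. A path from $i$ to $j$ is *direction-preserving* if $i<j$. Let $B_{\max}$ be the subalgebra of $A$ generated by $L$ and all direction-preserving paths. A path $x$ in $A$ is *right-minimal direction-preserving* if $x\in B_{\max}$ and $x\notin\operatorname{rad}(A)\operatorname{rad}(B_{\max})$ (the trivial paths are included), and $B_{\min}$ is the subalgebra of $A$ generated by these paths. Let $C_{\min}$ be the analogously defined subalgebra of $A^{op}$ (with the same order on the vertices and with the paths of $A$ reversed), and $C_{\min}^{op}$ the corresponding subalgebra of $A$. Then: 1. If $B$ is an exact Borel subalgebra of $A$ containing all trivial and all right-minimal direction-preserving paths, then $B=B_{\min}$. 2. An exact Borel subalgebra of $A$ has a basis consisting of paths if and only if it contains all trivial and all right-minimal direction-preserving paths. 3. $B_{\min}$ is an exact Borel subalgebra of $A$ with a basis consisting of paths, and it is the only one. 4. $C_{\min}^{op}$ is a $\Delta$-subalgebra of $A$ with a basis consisting of paths, and it is the only one. -/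

import Mathlib

/-! Path algebras, monomial algebras, quasi-hereditary algebras and exact Borel subalgebras. -/

universe u v w

namespace MonomialQH

open scoped TensorProduct

/-! ### The path algebra of a quiver with vertices `0 < 1 < ⋯ < n - 1` -/

section PathAlgebra

variable {n : ℕ}

/-- A path in the quiver `Q`, of any length `≥ 0`, together with its source and its target. -/
structure QPath (Q : Quiver.{v} (Fin n)) : Type v where
  src : Fin n
  tgt : Fin n
  path : Quiver.Path src tgt

variable {Q : Quiver.{v} (Fin n)}

/-- The number of arrows of a path. -/
def QPath.length (p : QPath Q) : ℕ := p.path.length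

/-- The trivial path at the vertex `i`. -/
def QPath.trivial (Q : Quiver.{v} (Fin n)) (i : Fin n) : QPath Q := ⟨i, i, Quiver.Path.nil⟩

/-- The concatenation `p q`: first `q`, then `p`. -/
def QPath.comp (p q : QPath Q) (h : q.tgt = p.src) : QPath Q :=
  ⟨q.src, p.tgt, (q.path.cast rfl h).comp p.path⟩

theorem QPath.comp_assoc (p q r : QPath Q) (h : q.tgt = p.src) (h' : r.tgt = q.src) :
    (p.comp q h).comp r h' = p.comp (q.comp r h') h := by
  obtain ⟨a, b, p⟩ := p
  obtain ⟨c, d, q⟩ := q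
  obtain ⟨e, f, r⟩ := r
  dsimp only at h h'
  subst h h'
  simp [QPath.comp]

theorem QPath.comp_trivial (p : QPath Q) : p.comp (QPath.trivial Q p.src) rfl = p := by
  obtain ⟨a, b, p⟩ := p
  simp [QPath.comp, QPath.trivial]

theorem QPath.trivial_comp (p : QPath Q) : (QPath.trivial Q p.tgt).comp p rfl = p := by
  obtain ⟨a, b, p⟩ := p
  simp [QPath.comp, QPath.trivial]

variable (k : Type u) [Field k]

/-- The path algebra `kQ`: the vector space with basis the paths of `Q`. -/
def PathAlgebra (Q : Quiver.{v} (Fin n)) : Type (max u v) := QPath Q →₀ k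

noncomputable instance : AddCommGroup (PathAlgebra k Q) :=
  inferInstanceAs (AddCommGroup (QPath Q →₀ k))

noncomputable instance : Module k (PathAlgebra k Q) :=
  inferInstanceAs (Module k (QPath Q →₀ k))

/-- A path as an element of the path algebra. -/
noncomputable def PathAlgebra.of (p : QPath Q) : PathAlgebra k Q :=
  (Finsupp.single p 1 : QPath Q →₀ k)

/-- The product of two paths: their concatenation `p q` (first `q`, then `p`) if `q` ends where
`p` starts, and `0` otherwise. -/
noncomputable def PathAlgebra.mulPath (p q : QPath Q) : PathAlgebra k Q :=
  if h : q.tgt = p.src then PathAlgebra.of k (p.comp q h) else 0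

/-- The bilinear extension of the product of paths. -/
noncomputable def PathAlgebra.mulLin :
    PathAlgebra k Q →ₗ[k] PathAlgebra k Q →ₗ[k] PathAlgebra k Q :=
  Finsupp.linearCombination k (fun p : QPath Q =>
    (Finsupp.linearCombination k (fun q : QPath Q => PathAlgebra.mulPath k p q) :
      (QPath Q →₀ k) →ₗ[k] PathAlgebra k Q))

noncomputable instance : Mul (PathAlgebra k Q) := ⟨fun x y => PathAlgebra.mulLin k x y⟩

noncomputable instance : One (PathAlgebra k Q) :=
  ⟨∑ i : Fin n, PathAlgebra.of k (QPath.trivial Q i)⟩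

theorem PathAlgebra.mul_def (x y : PathAlgebra k Q) : x * y = PathAlgebra.mulLin k x y := rfl

theorem PathAlgebra.one_def :
    (1 : PathAlgebra k Q) = ∑ i : Fin n, PathAlgebra.of k (QPath.trivial Q i) := rfl

theorem PathAlgebra.of_mul_of (p q : QPath Q) :
    PathAlgebra.of k p * PathAlgebra.of k q = PathAlgebra.mulPath k p q := by
  rw [PathAlgebra.mul_def, PathAlgebra.mulLin, PathAlgebra.of, PathAlgebra.of]
  erw [Finsupp.linearCombination_single, one_smul, Finsupp.linearCombination_single, one_smul]

theorem PathAlgebra.induction {P : PathAlgebra k Q → Prop} (x : PathAlgebra k Q)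
    (h0 : P 0) (hadd : ∀ x y, P x → P y → P (x + y))
    (hof : ∀ (c : k) (p : QPath Q), P (c • PathAlgebra.of k p)) : P x := by
  refine Finsupp.induction_linear (motive := P) x h0 hadd (fun p c => ?_)
  have := hof c p
  rw [PathAlgebra.of] at this
  erw [Finsupp.smul_single, smul_eq_mul, mul_one] at this
  exact this

theorem PathAlgebra.mulPath_assoc (p q r : QPath Q) :
    PathAlgebra.mulPath k p q * PathAlgebra.of k r
      = PathAlgebra.of k p * PathAlgebra.mulPath k q r := by
  by_cases h : q.tgt = p.src
  · by_cases h' : r.tgt = q.src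
    · have h1 : r.tgt = (p.comp q h).src := h'
      have h2 : (q.comp r h').tgt = p.src := h
      rw [PathAlgebra.mulPath, dif_pos h, PathAlgebra.mulPath, dif_pos h', PathAlgebra.of_mul_of,
        PathAlgebra.of_mul_of, PathAlgebra.mulPath, dif_pos h1, PathAlgebra.mulPath, dif_pos h2]
      exact congrArg (PathAlgebra.of k) (QPath.comp_assoc p q r h h')
    · have h1 : ¬ r.tgt = (p.comp q h).src := h'
      rw [PathAlgebra.mulPath, dif_pos h, PathAlgebra.mulPath, dif_neg h', PathAlgebra.of_mul_of,
        PathAlgebra.mulPath, dif_neg h1, PathAlgebra.mul_def, map_zero]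
  · by_cases h' : r.tgt = q.src
    · have h2 : ¬ (q.comp r h').tgt = p.src := h
      rw [PathAlgebra.mulPath, dif_neg h, PathAlgebra.mulPath, dif_pos h', PathAlgebra.of_mul_of,
        PathAlgebra.mulPath, dif_neg h2, PathAlgebra.mul_def, map_zero, LinearMap.zero_apply]
    · rw [PathAlgebra.mulPath, dif_neg h, PathAlgebra.mulPath, dif_neg h', PathAlgebra.mul_def,
        PathAlgebra.mul_def, map_zero, map_zero, LinearMap.zero_apply]

theorem PathAlgebra.smul_mul (c : k) (x y : PathAlgebra k Q) : (c • x) * y = c • (x * y) := by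
  simp only [PathAlgebra.mul_def, map_smul, LinearMap.smul_apply]

theorem PathAlgebra.mul_smul' (c : k) (x y : PathAlgebra k Q) : x * (c • y) = c • (x * y) := by
  simp only [PathAlgebra.mul_def, map_smul]

theorem PathAlgebra.add_mul' (x y z : PathAlgebra k Q) : (x + y) * z = x * z + y * z := by
  simp only [PathAlgebra.mul_def, map_add, LinearMap.add_apply]

theorem PathAlgebra.mul_add' (x y z : PathAlgebra k Q) : x * (y + z) = x * y + x * z := by
  simp only [PathAlgebra.mul_def, map_add]

theorem PathAlgebra.zero_mul' (x : PathAlgebra k Q) : 0 * x = 0 := by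
  simp only [PathAlgebra.mul_def, map_zero, LinearMap.zero_apply]

theorem PathAlgebra.mul_zero' (x : PathAlgebra k Q) : x * 0 = 0 := by
  simp only [PathAlgebra.mul_def, map_zero]

theorem PathAlgebra.mul_assoc' (x y z : PathAlgebra k Q) : x * y * z = x * (y * z) := by
  induction x using PathAlgebra.induction with
  | h0 => simp only [PathAlgebra.zero_mul']
  | hadd x x' hx hx' => simp only [PathAlgebra.add_mul', hx, hx']
  | hof a p =>
    induction y using PathAlgebra.induction with
    | h0 => simp only [PathAlgebra.zero_mul', PathAlgebra.mul_zero']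
    | hadd y y' hy hy' => simp only [PathAlgebra.add_mul', PathAlgebra.mul_add', hy, hy']
    | hof b q =>
      induction z using PathAlgebra.induction with
      | h0 => simp only [PathAlgebra.mul_zero']
      | hadd z z' hz hz' => simp only [PathAlgebra.mul_add', hz, hz']
      | hof c r =>
        simp only [PathAlgebra.smul_mul, PathAlgebra.mul_smul', PathAlgebra.of_mul_of,
          PathAlgebra.mulPath_assoc]

theorem PathAlgebra.one_mul' (x : PathAlgebra k Q) : 1 * x = x := by
  induction x using PathAlgebra.induction with
  | h0 => simp only [PathAlgebra.mul_zero']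
  | hadd x x' hx hx' => simp only [PathAlgebra.mul_add', hx, hx']
  | hof a p =>
    rw [PathAlgebra.mul_smul', PathAlgebra.one_def, PathAlgebra.mul_def, map_sum,
      LinearMap.sum_apply]
    simp only [← PathAlgebra.mul_def, PathAlgebra.of_mul_of]
    rw [Finset.sum_eq_single p.tgt]
    · rw [PathAlgebra.mulPath, dif_pos (show p.tgt = (QPath.trivial Q p.tgt).src from rfl),
        QPath.trivial_comp]
    · intro i _ hi
      exact dif_neg (fun h => hi h.symm)
    · intro h
      exact absurd (Finset.mem_univ _) h

theorem PathAlgebra.mul_one' (x : PathAlgebra k Q) : x * 1 = x := by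
  induction x using PathAlgebra.induction with
  | h0 => simp only [PathAlgebra.zero_mul']
  | hadd x x' hx hx' => simp only [PathAlgebra.add_mul', hx, hx']
  | hof a p =>
    rw [PathAlgebra.smul_mul, PathAlgebra.one_def, PathAlgebra.mul_def, map_sum]
    simp only [← PathAlgebra.mul_def, PathAlgebra.of_mul_of]
    rw [Finset.sum_eq_single p.src]
    · rw [PathAlgebra.mulPath, dif_pos (show (QPath.trivial Q p.src).tgt = p.src from rfl),
        QPath.comp_trivial]
    · intro i _ hi
      exact dif_neg hi
    · intro h
      exact absurd (Finset.mem_univ _) h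

noncomputable instance : Ring (PathAlgebra k Q) where
  __ := (inferInstance : AddCommGroup (PathAlgebra k Q))
  mul_assoc := PathAlgebra.mul_assoc' k
  one_mul := PathAlgebra.one_mul' k
  mul_one := PathAlgebra.mul_one' k
  left_distrib := PathAlgebra.mul_add' k
  right_distrib := PathAlgebra.add_mul' k
  zero_mul := PathAlgebra.zero_mul' k
  mul_zero := PathAlgebra.mul_zero' k

noncomputable instance : Algebra k (PathAlgebra k Q) :=
  Algebra.ofModule (PathAlgebra.smul_mul k) (PathAlgebra.mul_smul' k)

/-! ### Monomial algebras -/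

/-- The two-sided ideal `I` of `kQ` generated by a set `R` of paths. -/
noncomputable def monomialIdeal (R : Set (QPath Q)) : TwoSidedIdeal (PathAlgebra k Q) :=
  TwoSidedIdeal.span (PathAlgebra.of k '' R)

/-- The monomial algebra `A = kQ / I`. -/
abbrev MonomialAlgebra (R : Set (QPath Q)) : Type (max u v) :=
  (monomialIdeal k R).ringCon.Quotient

/-- The residue class `p + I` in `A = kQ / I` of a path `p` of `Q`. -/
noncomputable def pathClass (R : Set (QPath Q)) (p : QPath Q) : MonomialAlgebra k R :=
  (monomialIdeal k R).ringCon.mk' (PathAlgebra.of k p)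

/-- The idempotent `e_i + I` of `A = kQ / I`. -/
noncomputable def vertexIdem (R : Set (QPath Q)) (i : Fin n) : MonomialAlgebra k R :=
  pathClass k R (QPath.trivial Q i)

/-- The paths in `A = kQ / I`: the residue classes `p + I` of the paths `p ∉ I` of `Q`. -/
def pathSet (R : Set (QPath Q)) : Set (MonomialAlgebra k R) :=
  {x | ∃ p : QPath Q, PathAlgebra.of k p ∉ monomialIdeal k R ∧ x = pathClass k R p}

/-- `I` is an admissible ideal generated by the set `R` of paths: all paths in `R` have length at
least two, and `I` contains all sufficiently long paths. -/
def IsAdmissible (R : Set (QPath Q)) : Prop :=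
  (∀ p ∈ R, 2 ≤ p.length) ∧
    ∃ N : ℕ, ∀ p : QPath Q, N ≤ p.length → PathAlgebra.of k p ∈ monomialIdeal k R

end PathAlgebra

/-! ### Standard modules and quasi-hereditary algebras

Here `A` is a ring with a family `e : Fin n → A` of idempotents. In the application `A` is a basic
algebra and `e` a complete family of primitive orthogonal idempotents, so that `Sim(A)` consists of
the simple modules `L_i` below, with `L_i ≤ L_j` if and only if `i ≤ j`. -/

section QuasiHereditary

variable {A : Type w} [Ring A] {n : ℕ} (e : Fin n → A)

/-- The projective module `P_i = A e_i`. -/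
abbrev Proj (i : Fin n) : Submodule A A := Submodule.span A {e i}

/-- The simple module `L_i = P_i / rad P_i`. -/
abbrev Simp (i : Fin n) : Type w := Proj e i ⧸ Module.jacobson A (Proj e i)

/-- The submodule of `P_i` generated by all `e_j P_i` with `j > i`, that is, the trace in `P_i` of
the modules `P_j` with `j > i`. As `[M : L_j] = 0` means `e_j M = 0`, it is the smallest submodule
`U` of `P_i` such that `[P_i / U : L_j] = 0` for all `j > i`. -/
def stdKernel (i : Fin n) : Submodule A (Proj e i) :=
  Submodule.span A {x | ∃ j : Fin n, i < j ∧ ∃ y : Proj e i, x = e j • y}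

/-- The standard module `Δ_i`: the maximal factor module of `P_i` with `[Δ_i : L_j] = 0` for all
`j > i`. -/
abbrev Std (i : Fin n) : Type w := Proj e i ⧸ stdKernel e i

/-- `M` belongs to `filt(Δ)`: it has a finite filtration whose subquotients are standard
modules. -/
def HasStdFiltration (M : Type w) [AddCommGroup M] [Module A M] : Prop :=
  ∃ (m : ℕ) (F : ℕ → Submodule A M), F 0 = ⊥ ∧ F m = ⊤ ∧
    ∀ l < m, F l ≤ F (l + 1) ∧
      ∃ i : Fin n, Nonempty ((F (l + 1) ⧸ (F l).submoduleOf (F (l + 1))) ≃ₗ[A] Std e i)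

/-- `(A, ≤)` is quasi-hereditary: `A` has a filtration by standard modules, and
`End_A(Δ_i) ≅ k` for all `i`. -/
def IsQuasiHereditary (k : Type u) [Field k] [Algebra k A] : Prop :=
  HasStdFiltration e A ∧ ∀ i, Nonempty (Module.End A (Std e i) ≃ₐ[k] k)

end QuasiHereditary

/-! ### Exact Borel subalgebras -/

section ExactBorel

variable {k : Type u} [Field k] {A : Type w} [Ring A] [Algebra k A] (B : Subalgebra k A)

section Induction

variable (M N : Type w) [AddCommGroup M] [Module B M] [AddCommGroup N] [Module B N]

/-- The `A`-submodule of `A ⊗_ℤ M` generated by the elements `a b ⊗ m - a ⊗ b m` with `b ∈ B`. -/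
def balancedRel : Submodule A (A ⊗[ℤ] M) :=
  Submodule.span A {x | ∃ (a : A) (b : B) (m : M), x = (a * (b : A)) ⊗ₜ[ℤ] m - a ⊗ₜ[ℤ] (b • m)}

/-- The induced left `A`-module `A ⊗_B M` of a left `B`-module `M`. -/
abbrev Ind : Type w := (A ⊗[ℤ] M) ⧸ balancedRel B M

variable {M N}

/-- The `A`-linear map `id ⊗ f : A ⊗_ℤ M → A ⊗_ℤ N`. -/
noncomputable def idTensor (f : M →ₗ[B] N) : A ⊗[ℤ] M →ₗ[A] A ⊗[ℤ] N :=
  TensorProduct.AlgebraTensorModule.map (LinearMap.id : A →ₗ[A] A)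
    (f.toAddMonoidHom.toIntLinearMap)

theorem balancedRel_le_comap (f : M →ₗ[B] N) :
    balancedRel B M ≤ (balancedRel B N).comap (idTensor B f) := by
  rw [balancedRel, Submodule.span_le]
  rintro _ ⟨a, b, m, rfl⟩
  refine Submodule.subset_span ⟨a, b, f m, ?_⟩
  simp [idTensor]

/-- The induction functor `A ⊗_B -` on morphisms. -/
noncomputable def indMap (f : M →ₗ[B] N) : Ind B M →ₗ[A] Ind B N :=
  Submodule.mapQ _ _ (idTensor B f) (balancedRel_le_comap B f)

end Induction

/-- The induction functor `A ⊗_B -` is exact on finitely generated `B`-modules. -/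
def IndExact : Prop :=
  ∀ (M N P : Type w) [AddCommGroup M] [AddCommGroup N] [AddCommGroup P]
    [Module B M] [Module B N] [Module B P]
    [Module.Finite B M] [Module.Finite B N] [Module.Finite B P]
    (f : M →ₗ[B] N) (g : N →ₗ[B] P),
    Function.Exact f g → Function.Exact (indMap B f) (indMap B g)

open scoped ModuleCat in
/-- `B` is an exact Borel subalgebra of `(A, ≤)`: the functor `A ⊗_B -` is exact, and the simple
`B`-modules can be labelled (by a bijection `Sim(B) ≅ Sim(A) = {L_i}`, `S i ↦ L_i`) such that
`A ⊗_B S i ≅ Δ_i`, `End_B(S i) ≅ End_A(L_i)` and `Ext¹_B(S i, S j) ≠ 0` only if `i ≤ j`. -/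
def IsExactBorel {n : ℕ} (e : Fin n → A) : Prop :=
  IndExact B ∧
  ∃ S : Fin n → ModuleCat.{w} B,
    (∀ i, IsSimpleModule B (S i)) ∧
    (∀ i j, Nonempty (S i ≃ₗ[B] S j) → i = j) ∧
    (∀ M : ModuleCat.{w} B, IsSimpleModule B M → ∃ i, Nonempty (M ≃ₗ[B] S i)) ∧
    (∀ i, Nonempty (Ind B (S i) ≃ₗ[A] Std e i)) ∧
    (∀ i, Nonempty (Module.End B (S i) ≃ₐ[k] Module.End A (Simp e i))) ∧
    (∀ i j, Nontrivial (CategoryTheory.Abelian.Ext.{w} (S i) (S j) 1) → i ≤ j)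

/-- `C` is a `Δ`-subalgebra of `(A, ≤)`: the opposite algebra of `C` is an exact Borel subalgebra
of `(Aᵒᵖ, ≤)`. -/
def IsDeltaSubalgebra {n : ℕ} (e : Fin n → A) (C : Subalgebra k A) : Prop :=
  IsExactBorel C.op (fun i => MulOpposite.op (e i))

end ExactBorel

/-! ### Direction-preserving paths

Here `A` is a `k`-algebra, `e_i` are the trivial paths and `paths` is the set of all paths in `A`.
A path `x` in `A` from `i` to `j` satisfies `x = e_j x e_i`. -/

section Paths

variable (k : Type u) [Field k] {A : Type w} [Ring A] [Algebra k A] {n : ℕ} (e : Fin n → A)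
  (paths : Set A)

/-- `x ∈ e_j A e_i` for some `i < j`. -/
def IsDirectionPreserving (x : A) : Prop := ∃ i j : Fin n, i < j ∧ x = e j * x * e i

/-- The subalgebra generated by `L = ⟨e_1, …, e_n⟩` and all direction-preserving paths. -/
def Bmax : Subalgebra k A :=
  Algebra.adjoin k (Set.range e ∪ {x ∈ paths | IsDirectionPreserving e x})

/-- The product `rad(A) rad(B_max)`: the span of all products. -/
def radRad : Submodule k A :=
  Submodule.span k
    {x | ∃ a ∈ Ring.jacobson A, ∃ b ∈ Ring.jacobson (Bmax k e paths), x = a * (b : A)}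

/-- `x` is right-minimal direction-preserving: `x ∈ B_max` and `x ∉ rad(A) rad(B_max)`. -/
def IsRightMinimal (x : A) : Prop := x ∈ Bmax k e paths ∧ x ∉ radRad k e paths

/-- The subalgebra generated by all right-minimal direction-preserving paths. (The trivial paths
are among these.) -/
def Bmin : Subalgebra k A := Algebra.adjoin k {x ∈ paths | IsRightMinimal k e paths x}

variable {k} in
/-- The subalgebra `B` has a vector space basis consisting of paths. -/
def HasPathBasis (B : Subalgebra k A) : Prop :=
  ∃ S ⊆ paths, LinearIndependent k (fun x : S => (x : A)) ∧
    Submodule.span k S = Subalgebra.toSubmodule B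

variable {k} in
/-- `B` contains all trivial paths and all right-minimal direction-preserving paths. -/
def ContainsRightMinimal (B : Subalgebra k A) : Prop :=
  (∀ i, e i ∈ B) ∧ ∀ x ∈ paths, IsRightMinimal k e paths x → x ∈ B

/-- The subalgebra `C_minᵒᵖ` of `A`, where `C_min` is the subalgebra of `Aᵒᵖ` generated by all
right-minimal direction-preserving paths in `Aᵒᵖ`. The paths in `Aᵒᵖ` are the paths in `A`,
traversed backwards. -/
def CminOp : Subalgebra k A :=
  (Bmin k (fun i => MulOpposite.op (e i)) (MulOpposite.op '' paths)).unop

end Paths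

end MonomialQH

universe x

namespace MonomialQH

open scoped TensorProduct

/-! Everything reduces to the combinatorics of the nonzero paths of `A`. Call a path a D-path if all
its vertices are at most its source, and a B-path if all are at most its target. Cutting a path at a
maximal vertex writes it as `u c` with `u` a D-path and `c` a B-path. The D-paths from `i` represent
a basis of `Δ_i`.

Quasi-heredity enters through two combinatorial consequences. A nontrivial D-path that is a cycle at
`i` would give a nonzero nilpotent endomorphism of `Δ_i`, so there is none (`noCycle_of_end`). In a
standard filtration of `A` the multiplicity of `Δ_j` is at least the number of B-paths ending at
`j`. Comparing dimensions, there are at least as many paths as composable pairs of a D-path and a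
B-path, while the cut at a maximal vertex injects paths into such pairs. Hence every pair occurs,
and no such concatenation vanishes (`noRelation_of_filtration`).

Existence: the B-paths span a subalgebra `borel`. Unique cutting gives `A` a dual basis as a right
`borel`-module, so induction is exact. The radical of `borel` generates the expected kernels of `A →
Δ_i`, and B-paths never go down, which gives the condition on `Ext¹`. Cutting off shortest
direction-preserving initial segments shows that `borel` is `Bmin` (`Bmin_eq_borel`).

Uniqueness: if an exact Borel subalgebra `B` contains `borel`, the maximal left ideals belonging to
the vertices generate the same left ideals of `A` for both, namely the kernels of `A → Δ_i`.
Exactness and `Δ_l ≠ 0` then allow a Nakayama-type argument showing that these ideals of `B` are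
already generated by elements of `borel`, and induction on path length gives equality (`eq_of_le`).
A path basis forces the right-minimal paths into `B`, since each must be a left multiple of a path
of `B` that itself has a direction-preserving initial segment.

The notion `MonomialBasis` is stable under reversal, which exchanges D-paths and B-paths, so the
statement on `Δ`-subalgebras is the one on exact Borel subalgebras for the opposite algebra. -/

/-- A basis of an algebra consisting of paths: the products of basis elements are basis elements
or zero, and basis elements factor uniquely as they do in a path category. -/
structure MonomialBasis (k : Type u) [Field k] {A : Type w} [Ring A] [Algebra k A] {n : ℕ}
    (e : Fin n → A) (P : Type x) where
  basis : Module.Basis P k A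
  src : P → Fin n
  tgt : P → Fin n
  len : P → ℕ
  triv : Fin n → P
  basis_triv : ∀ i, basis (triv i) = e i
  sum_e : ∑ i, e i = 1
  src_triv : ∀ i, src (triv i) = i
  tgt_triv : ∀ i, tgt (triv i) = i
  len_triv : ∀ i, len (triv i) = 0
  eq_triv : ∀ p, len p = 0 → p = triv (src p)
  e_mul : ∀ p, e (tgt p) * basis p = basis p
  mul_e : ∀ p, basis p * e (src p) = basis p
  mul_of_ne : ∀ p q, src p ≠ tgt q → basis p * basis q = 0
  mul_eq : ∀ p q, basis p * basis q = 0 ∨ ∃ r, basis p * basis q = basis r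
  src_mul : ∀ {p q r}, basis p * basis q = basis r → src r = src q
  tgt_mul : ∀ {p q r}, basis p * basis q = basis r → tgt r = tgt p
  len_mul : ∀ {p q r}, basis p * basis q = basis r → len r = len p + len q
  split : ∀ r l, l ≤ len r → ∃ p q, basis p * basis q = basis r ∧ len q = l
  cancel : ∀ {p q p' q' r}, basis p * basis q = basis r → basis p' * basis q' = basis r →
    len q = len q' → p = p' ∧ q = q'

/-! ### Factorisations of paths and maximal vertices -/

namespace MonomialBasis

variable {k : Type u} [Field k] {A : Type w} [Ring A] [Algebra k A] {n : ℕ}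
  {e : Fin n → A} {P : Type x} (b : MonomialBasis k e P)

/-- `p` is the concatenation `q r`. -/
def Fac (p q r : P) : Prop := b.basis q * b.basis r = b.basis p

/-- All vertices of `p` are at most its source. -/
def IsD (p : P) : Prop := ∀ q r, b.Fac p q r → b.tgt r ≤ b.src p

/-- All vertices of `p` are at most its target. -/
def IsB (p : P) : Prop := ∀ q r, b.Fac p q r → b.tgt r ≤ b.tgt p

/-- The span of a set of paths. -/
def sp (T : Set P) : Submodule k A := Submodule.span k (b.basis '' T)

variable {b}

theorem basis_ne (p : P) : b.basis p ≠ 0 := b.basis.ne_zero p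

theorem Fac.src_eq {p q r : P} (h : b.Fac p q r) : b.src q = b.tgt r := by
  by_contra hne
  exact basis_ne p (h ▸ b.mul_of_ne q r hne)

theorem Fac.src {p q r : P} (h : b.Fac p q r) : b.src p = b.src r := b.src_mul h
theorem Fac.tgt {p q r : P} (h : b.Fac p q r) : b.tgt p = b.tgt q := b.tgt_mul h
theorem Fac.len {p q r : P} (h : b.Fac p q r) : b.len p = b.len q + b.len r := b.len_mul h

theorem fac_src (p : P) : b.Fac p p (b.triv (b.src p)) := by
  rw [Fac, b.basis_triv, b.mul_e]

theorem fac_tgt (p : P) : b.Fac p (b.triv (b.tgt p)) p := by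
  rw [Fac, b.basis_triv, b.e_mul]

theorem exists_fac {p q : P} (h : b.basis p * b.basis q ≠ 0) : ∃ r, b.Fac r p q :=
  (b.mul_eq p q).resolve_left h

theorem Fac.eq_left {p q r : P} (h : b.Fac p q r) (hr : b.len r = 0) : p = q :=
  (b.cancel h (fac_src p) (by rw [hr, b.len_triv])).1.symm

theorem Fac.eq_right {p q r : P} (h : b.Fac p q r) (hq : b.len q = 0) : p = r :=
  (b.cancel h (fac_tgt p) (by have := h.len; omega)).2.symm

theorem eq_triv_tgt {p : P} (hp : b.len p = 0) : p = b.triv (b.tgt p) := by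
  have h := b.eq_triv p hp
  rw [h, b.tgt_triv]

/-- Associativity of concatenations: `p = q (r s)` implies `p = (q r) s`. -/
theorem Fac.assoc_left {p q t r s : P} (h : b.Fac p q t) (h' : b.Fac t r s) :
    ∃ z, b.Fac p z s ∧ b.Fac z q r := by
  have h1 : b.basis q * b.basis r * b.basis s = b.basis p := by
    rw [mul_assoc]
    exact (congrArg _ h').trans h
  obtain ⟨z, hz⟩ := exists_fac (b := b) (p := q) (q := r) (fun h0 => by
    rw [h0, zero_mul] at h1
    exact basis_ne p h1.symm)
  exact ⟨z, by rw [Fac, ← h1, hz], hz⟩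

/-- Associativity of concatenations: `p = (q r) s` implies `p = q (r s)`. -/
theorem Fac.assoc_right {p t q r s : P} (h : b.Fac p t s) (h' : b.Fac t q r) :
    ∃ z, b.Fac p q z ∧ b.Fac z r s := by
  have h1 : b.basis q * (b.basis r * b.basis s) = b.basis p := by
    rw [← mul_assoc]
    exact (congrArg (· * b.basis s) h').trans h
  obtain ⟨z, hz⟩ := exists_fac (b := b) (p := r) (q := s) (fun h0 => by
    rw [h0, mul_zero] at h1
    exact basis_ne p h1.symm)
  exact ⟨z, by rw [Fac, ← h1, hz], hz⟩

/-- Two initial segments of a path are comparable. -/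
theorem Fac.compare {p q r q' r' : P} (h : b.Fac p q r) (h' : b.Fac p q' r')
    (hl : b.len r ≤ b.len r') : ∃ c, b.Fac r' c r ∧ b.Fac q q' c := by
  obtain ⟨c, s, hc, hs⟩ := b.split r' _ hl
  obtain ⟨z, hz, hz'⟩ := h'.assoc_left hc
  obtain ⟨rfl, rfl⟩ := b.cancel hz h hs
  exact ⟨c, hc, hz'⟩

theorem IsD.left {p q r : P} (h : b.Fac p q r) (hp : b.IsD p) (hq : b.tgt r = b.src p) :
    b.IsD q := by
  intro s t hst
  obtain ⟨z, hz, hz'⟩ := h.assoc_right hst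
  rw [← hz'.tgt, h.src_eq, hq]
  exact hp _ _ hz

theorem IsD.right {p q r : P} (h : b.Fac p q r) (hp : b.IsD p) : b.IsD r := by
  intro s t hst
  obtain ⟨z, hz, hz'⟩ := h.assoc_left hst
  rw [← h.src]
  exact hp _ _ hz

theorem isD_triv (i : Fin n) : b.IsD (b.triv i) := by
  intro q r h
  have := h.len
  rw [b.len_triv] at this
  have hr := h.eq_right (by omega)
  rw [← hr, b.tgt_triv, b.src_triv]

theorem isB_triv (i : Fin n) : b.IsB (b.triv i) := by
  intro q r h
  have := isD_triv i q r h
  rw [b.src_triv] at this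
  rwa [b.tgt_triv]

theorem IsB.src_le {p : P} (h : b.IsB p) : b.src p ≤ b.tgt p := by
  have := h _ _ (fac_src p)
  rwa [b.tgt_triv] at this

theorem IsD.tgt_le {p : P} (h : b.IsD p) : b.tgt p ≤ b.src p := h _ _ (fac_tgt p)

/-- An initial segment of `q r` either contains `r`, and then ends inside `q`, or lies in `r`, whose
vertices are at most `tgt r = src q ≤ tgt q`. -/
theorem IsB.mul {p q r : P} (h : b.Fac p q r) (hq : b.IsB q) (hr : b.IsB r) : b.IsB p := by
  intro s t hst
  rcases le_total (b.len r) (b.len t) with hl | hl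
  · obtain ⟨c, hc, hc'⟩ := h.compare hst hl
    rw [hc.tgt, h.tgt]
    exact hq _ _ hc'
  · obtain ⟨c, hc, hc'⟩ := hst.compare h hl
    calc b.tgt t ≤ b.tgt r := hr _ _ hc
      _ = b.src q := h.src_eq.symm
      _ ≤ b.tgt q := hq.src_le
      _ = b.tgt p := h.tgt.symm

theorem IsB.left {p q r : P} (h : b.Fac p q r) (hp : b.IsB p) : b.IsB q := by
  intro s t hst
  obtain ⟨z, hz, hz'⟩ := h.assoc_right hst
  rw [← hz'.tgt, ← h.tgt]
  exact hp _ _ hz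

/-- Every path factors at its maximal vertex. -/
theorem exists_fac_max (w : P) : ∃ u c, b.Fac w u c ∧ b.IsD u ∧ b.IsB c := by
  classical
  have hne : ({i | ∃ q r, b.Fac w q r ∧ b.tgt r = i} : Set (Fin n)).Nonempty :=
    ⟨_, _, _, fac_tgt w, rfl⟩
  obtain ⟨i, ⟨u, c, h, rfl⟩, hmax⟩ := Set.exists_max_image _ id (Set.toFinite _) hne
  refine ⟨u, c, h, fun q r hqr => ?_, fun q r hqr => ?_⟩
  · obtain ⟨z, hz, hz'⟩ := h.assoc_right hqr
    rw [← hz'.tgt, h.src_eq]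
    exact hmax _ ⟨_, _, hz, rfl⟩
  · obtain ⟨z, hz, hz'⟩ := h.assoc_left hqr
    exact hmax _ ⟨_, _, hz, rfl⟩

/-- There are no nontrivial cycles at a vertex through vertices that are at most this vertex. -/
def NoCycle (b : MonomialBasis k e P) : Prop := ∀ p, b.IsD p → b.tgt p = b.src p → b.len p = 0

/-- Concatenations at a maximal vertex are nonzero. -/
def NoRelation (b : MonomialBasis k e P) : Prop :=
  ∀ u c, b.IsD u → b.IsB c → b.src u = b.tgt c → b.basis u * b.basis c ≠ 0

/-- Two cuts differ by a segment between two visits to the maximal vertex. This segment is a D-path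
and a cycle, hence trivial. -/
theorem fac_max_unique (hC : b.NoCycle) {w u c u' c' : P} (h : b.Fac w u c) (h' : b.Fac w u' c')
    (hu : b.IsD u) (hu' : b.IsD u') (hc : b.IsB c) (hc' : b.IsB c') : u = u' ∧ c = c' := by
  wlog hl : b.len c ≤ b.len c' generalizing u c u' c'
  · have := this h' h hu' hu hc' hc (by omega)
    exact ⟨this.1.symm, this.2.symm⟩
  obtain ⟨d, hd, hd'⟩ := h.compare h' hl
  have h1 : b.tgt c ≤ b.tgt c' := hc' _ _ hd
  have h2 : b.tgt d ≤ b.src u := hu _ _ hd'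
  have h3 : b.tgt d = b.src d := by
    have e1 := hd.tgt
    have e2 := hd.src_eq
    have e3 := hd'.src
    refine le_antisymm (h2.trans_eq e3) ?_
    rw [e2, ← e1]
    exact h1
  have h0 := hC d (hu.right hd') h3
  exact ⟨hd'.eq_left h0, (hd.eq_right h0).symm⟩

/-! ### Spans of paths -/

theorem mem_sp {T : Set P} {a : A} : a ∈ b.sp T ↔ ∀ p, b.basis.repr a p ≠ 0 → p ∈ T := by
  rw [sp, b.basis.mem_span_image, Set.subset_def]
  simp

theorem basis_mem_sp {T : Set P} {p : P} : b.basis p ∈ b.sp T ↔ p ∈ T := by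
  classical
  rw [mem_sp]
  constructor
  · intro h
    exact h p (by simp)
  · intro h q hq
    rw [Module.Basis.repr_self, Finsupp.single_apply_ne_zero] at hq
    rwa [hq.1]

theorem sp_mono {T U : Set P} (h : T ⊆ U) : b.sp T ≤ b.sp U :=
  Submodule.span_mono (Set.image_mono h)

theorem sp_univ : b.sp Set.univ = ⊤ := by
  rw [sp, Set.image_univ, b.basis.span_eq]

theorem sp_empty : b.sp ∅ = ⊥ := by
  rw [sp, Set.image_empty, Submodule.span_empty]

theorem mem_sp_univ (a : A) : a ∈ b.sp Set.univ := sp_univ (b := b) ▸ Submodule.mem_top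

/-- Reduces closure of spans under products to a check on concatenations of paths. -/
theorem mul_mem_sp {T U V : Set P} (h : ∀ p ∈ T, ∀ q ∈ U, ∀ r, b.Fac r p q → r ∈ V) {x y : A}
    (hx : x ∈ b.sp T) (hy : y ∈ b.sp U) : x * y ∈ b.sp V := by
  have : b.sp T * b.sp U ≤ b.sp V := by
    rw [sp, sp, Submodule.span_mul_span, Submodule.span_le]
    rintro _ ⟨_, ⟨p, hp, rfl⟩, _, ⟨q, hq, rfl⟩, rfl⟩
    rcases b.mul_eq p q with h0 | ⟨r, hr⟩
    · simp only [h0, SetLike.mem_coe, Submodule.zero_mem]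
    · simp only [hr, SetLike.mem_coe, basis_mem_sp]
      exact h p hp q hq r hr
  exact this (Submodule.mul_mem_mul hx hy)

theorem sp_induction {T : Set P} {C : A → Prop} (h0 : C 0) (hadd : ∀ x y, C x → C y → C (x + y))
    (hsmul : ∀ (c : k) x, C x → C (c • x)) (hb : ∀ p ∈ T, C (b.basis p)) {a : A}
    (ha : a ∈ b.sp T) : C a := by
  refine Submodule.span_induction (p := fun x _ => C x) ?_ h0 (fun x y _ _ => hadd x y)
    (fun c x _ => hsmul c x) ha
  rintro _ ⟨p, hp, rfl⟩
  exact hb p hp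

theorem basis_induction {C : A → Prop} (h0 : C 0) (hadd : ∀ x y, C x → C y → C (x + y))
    (hsmul : ∀ (c : k) x, C x → C (c • x)) (hb : ∀ p, C (b.basis p)) (a : A) : C a :=
  sp_induction h0 hadd hsmul (fun p _ => hb p) (mem_sp_univ (b := b) a)

theorem e_mul_basis (i : Fin n) (p : P) :
    e i * b.basis p = if i = b.tgt p then b.basis p else 0 := by
  split_ifs with h
  · rw [h, b.e_mul]
  · rw [← b.basis_triv, b.mul_of_ne _ _ (by rwa [b.src_triv])]

theorem basis_mul_e (i : Fin n) (p : P) :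
    b.basis p * e i = if i = b.src p then b.basis p else 0 := by
  split_ifs with h
  · rw [h, b.mul_e]
  · rw [← b.basis_triv, b.mul_of_ne _ _ (by rw [b.tgt_triv]; exact fun h' => h h'.symm)]

theorem e_mul_e (b : MonomialBasis k e P) (i j : Fin n) : e i * e j = if i = j then e i else 0 := by
  conv_lhs => rw [← b.basis_triv j, e_mul_basis, b.tgt_triv, b.basis_triv]
  split_ifs with h
  · rw [h]
  · rfl

theorem e_mul_self (b : MonomialBasis k e P) (i : Fin n) : e i * e i = e i := by
  rw [b.e_mul_e, if_pos rfl]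

theorem mul_e_mem (a : A) (i : Fin n) : a * e i ∈ b.sp {p | b.src p = i} := by
  rw [← b.basis_triv]
  refine mul_mem_sp ?_ (mem_sp_univ a) (basis_mem_sp.2 (Set.mem_singleton (b.triv i)))
  rintro p - q rfl r h
  rw [Set.mem_ofPred_eq, h.src, b.src_triv]

theorem e_mul_mem (a : A) (i : Fin n) : e i * a ∈ b.sp {p | b.tgt p = i} := by
  rw [← b.basis_triv]
  refine mul_mem_sp ?_ (basis_mem_sp.2 (Set.mem_singleton (b.triv i))) (mem_sp_univ a)
  rintro p rfl q - r h
  rw [Set.mem_ofPred_eq, h.tgt, b.tgt_triv]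

/-! ### The characters of the algebra -/

/-- The coefficient at the trivial path `e_i`, as a character. -/
noncomputable def char (b : MonomialBasis k e P) (i : Fin n) : A →ₐ[k] k :=
  AlgHom.ofLinearMap (b.basis.coord (b.triv i)) (by
    classical
    rw [← b.sum_e, map_sum, Finset.sum_eq_single i]
    · rw [← b.basis_triv, b.basis.coord_apply, b.basis.repr_self, Finsupp.single_eq_same]
    · intro j _ hj
      rw [← b.basis_triv, b.basis.coord_apply, b.basis.repr_self, Finsupp.single_eq_of_ne]
      intro h
      apply hj
      rw [← b.src_triv i, ← b.src_triv j, h]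
    · simp) (by
    classical
    intro x y
    induction x using basis_induction (b := b) with
    | h0 => simp
    | hadd x x' hx hx' => rw [add_mul, map_add, map_add, hx, hx', add_mul]
    | hsmul c x hx => rw [smul_mul_assoc, map_smul, map_smul, hx, smul_mul_assoc]
    | hb p =>
    induction y using basis_induction (b := b) with
    | h0 => simp
    | hadd x x' hx hx' => rw [mul_add, map_add, map_add, hx, hx', mul_add]
    | hsmul c x hx => rw [mul_smul_comm, map_smul, map_smul, hx, mul_smul_comm]
    | hb q =>
    simp only [b.basis.coord_apply, b.basis.repr_self]
    by_cases hp : p = b.triv i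
    · subst hp
      rw [b.basis_triv, e_mul_basis, Finsupp.single_eq_same, one_mul]
      split_ifs with h
      · rw [b.basis.repr_self]
      · rw [Finsupp.single_eq_of_ne]
        · simp
        · rintro rfl
          exact h (b.tgt_triv _).symm
    · rw [Finsupp.single_eq_of_ne (fun h => hp h.symm), zero_mul]
      rcases b.mul_eq p q with h0 | ⟨r, hr⟩
      · simp [h0]
      · rw [hr, b.basis.repr_self, Finsupp.single_eq_of_ne]
        -- A product equal to `e_i` has length zero, so its left factor would be `e_i` itself.
        rintro rfl
        have h1 := Fac.len (b := b) hr
        rw [b.len_triv] at h1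
        exact hp (Fac.eq_left (b := b) hr (by omega)).symm)

theorem char_apply (i : Fin n) (a : A) : b.char i a = b.basis.repr a (b.triv i) := rfl

theorem char_e (i j : Fin n) : b.char i (e j) = if j = i then 1 else 0 := by
  classical
  rw [char_apply, ← b.basis_triv, b.basis.repr_self, Finsupp.single_apply]
  have : b.triv j = b.triv i ↔ j = i :=
    ⟨fun h => by rw [← b.src_triv i, ← b.src_triv j, h], fun h => by rw [h]⟩
  simp only [this]

theorem char_basis_of_len {p : P} (h : b.len p ≠ 0) (i : Fin n) : b.char i (b.basis p) = 0 := by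
  rw [char_apply, b.basis.repr_self, Finsupp.single_eq_of_ne]
  rintro rfl
  exact h (b.len_triv i)

theorem mem_sp_len_pos {a : A} : a ∈ b.sp {p | b.len p ≠ 0} ↔ ∀ i, b.char i a = 0 := by
  rw [mem_sp]
  constructor
  · intro h i
    by_contra hne
    exact h _ hne (b.len_triv i)
  · intro h p hp hl
    apply hp
    rw [b.eq_triv p hl]
    exact h _

theorem sub_sum_mem (a : A) : ∀ j, b.char j (a - ∑ i, b.char i a • e i) = 0 := by
  intro j
  rw [map_sub, map_sum, Finset.sum_eq_single j]
  · rw [map_smul, char_e, if_pos rfl, smul_eq_mul, mul_one, sub_self]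
  · intro i _ hi
    rw [map_smul, char_e, if_neg hi, smul_zero]
  · simp

theorem sp_len_eq_bot [Finite P] (b : MonomialBasis k e P) :
    ∃ N, ∀ a ∈ b.sp {p | N ≤ b.len p}, a = 0 := by
  obtain ⟨N, hN⟩ := (Set.finite_range b.len).bddAbove
  refine ⟨N + 1, fun a ha => ?_⟩
  rw [show {p | N + 1 ≤ b.len p} = ∅ from ?_, sp_empty] at ha
  · exact ha
  · ext p
    have := hN (Set.mem_range_self p)
    simp only [Set.mem_ofPred_eq, Set.mem_empty_iff_false, iff_false]
    omega

/-- The `m`-th power of such an element is supported on paths of length at least `m`, and lengths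
are bounded. -/
theorem isNilpotent [Finite P] {a : A} (h : ∀ i, b.char i a = 0) : IsNilpotent a := by
  obtain ⟨N, hN⟩ := b.sp_len_eq_bot
  refine ⟨N, hN _ ?_⟩
  have : ∀ m, a ^ m ∈ b.sp {p | m ≤ b.len p} := by
    intro m
    induction m with
    | zero => simpa using mem_sp_univ (b := b) _
    | succ m ih =>
      rw [pow_succ]
      refine mul_mem_sp ?_ ih (mem_sp_len_pos.2 h)
      intro p hp q hq r hr
      have := hr.len
      simp only [Set.mem_ofPred_eq] at *
      omega
  exact this N

end MonomialBasis

/-! ### Characters, the Jacobson radical and scalar endomorphisms -/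

section Characters

variable {k : Type u} [Field k] {S : Type w} [Ring S] [Algebra k S]

theorem isCoatom_ker (χ : S →ₐ[k] k) : IsCoatom (RingHom.ker χ : Submodule S S) := by
  refine ⟨fun h => ?_, fun N hN => ?_⟩
  · have : (1 : S) ∈ (RingHom.ker χ : Submodule S S) := h ▸ Submodule.mem_top
    have h1 : χ 1 = 0 := this
    rw [map_one] at h1
    exact one_ne_zero h1
  · obtain ⟨x, hxN, hx⟩ := Set.exists_of_ssubset hN
    have hx : χ x ≠ 0 := hx
    rw [Ideal.eq_top_iff_one N]
    have h1 : (1 - algebraMap k S (χ x)⁻¹ * x) ∈ (RingHom.ker χ : Submodule S S) := by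
      change χ _ = 0
      rw [map_sub, map_mul, map_one, AlgHom.commutes]
      simp [hx]
    have := N.add_mem (hN.le h1) (N.smul_mem (algebraMap k S (χ x)⁻¹) hxN)
    rwa [smul_eq_mul, sub_add_cancel] at this

/-- Kernels of characters are maximal left ideals. Conversely, if all characters vanish on `x`, then
`y * x` is nilpotent for every `y`, so `1 + y * x` is invertible. The criterion serves both `A` and
its subalgebras. -/
theorem mem_jacobson_iff_characters {ι : Type*} (χ : ι → S →ₐ[k] k)
    (h : ∀ x, (∀ i, χ i x = 0) → IsNilpotent x) (x : S) :
    x ∈ Ring.jacobson S ↔ ∀ i, χ i x = 0 := by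
  constructor
  · intro hx i
    have := Ideal.isMaximal_def.2 (isCoatom_ker (χ i))
    exact Ring.jacobson_le_of_isMaximal (RingHom.ker (χ i)) hx
  · intro hx
    rw [← Ideal.jacobson_bot, Ideal.mem_jacobson_iff]
    intro y
    have h1 : IsNilpotent (y * x) := h _ (fun i => by rw [map_mul, hx, mul_zero])
    obtain ⟨z, hz⟩ := h1.isUnit_one_add.exists_left_inv
    refine ⟨z, ?_⟩
    rw [mul_add, mul_one, ← mul_assoc] at hz
    rw [Ideal.mem_bot, ← hz]
    abel

theorem nonempty_end_algEquiv {M : Type*} [AddCommGroup M] [Module k M] [Module S M]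
    [IsScalarTower k S M] (g : M) (hg : g ≠ 0) (h : ∀ m : M, ∃ c : k, m = c • g) :
    Nonempty (Module.End S M ≃ₐ[k] k) := by
  refine ⟨(AlgEquiv.ofBijective (Algebra.ofId k (Module.End S M)) ⟨?_, ?_⟩).symm⟩
  · have : Nontrivial M := ⟨g, 0, hg⟩
    exact (Algebra.ofId k (Module.End S M)).toRingHom.injective
  · intro f
    obtain ⟨c, hc⟩ := h (f g)
    refine ⟨c, ?_⟩
    ext m
    obtain ⟨d, rfl⟩ := h m
    rw [Algebra.ofId_apply, Module.algebraMap_end_apply, ← algebraMap_smul S d g, map_smul, hc,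
      smul_comm, algebraMap_smul]

end Characters

namespace MonomialBasis

variable {k : Type u} [Field k] {A : Type w} [Ring A] [Algebra k A] {n : ℕ}
  {e : Fin n → A} {P : Type x} (b : MonomialBasis k e P)

theorem mem_jacobson [Finite P] (a : A) : a ∈ Ring.jacobson A ↔ ∀ i, b.char i a = 0 :=
  mem_jacobson_iff_characters b.char (fun _ => isNilpotent) a

/-! ### Standard modules -/

/-- The kernel of the canonical map `A → Δ_i`. It is spanned by all paths but those that start
in `i` and pass only through vertices `≤ i`. -/
def stdIdeal (i : Fin n) : Submodule A A where
  __ := b.sp {p | ¬ (b.IsD p ∧ b.src p = i)}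
  smul_mem' := by
    intro c x hx
    refine mul_mem_sp ?_ (mem_sp_univ c) hx
    rintro p - q hq r hr ⟨h1, h2⟩
    -- A right factor of a D-path from `i` is again one, so the complementary set is closed under
    -- left concatenation.
    exact hq ⟨h1.right hr, hr.src.symm.trans h2⟩

theorem mem_stdIdeal {i : Fin n} {a : A} :
    a ∈ b.stdIdeal i ↔ a ∈ b.sp {p | ¬ (b.IsD p ∧ b.src p = i)} := Iff.rfl

theorem basis_mem_stdIdeal {i : Fin n} {p : P} :
    b.basis p ∈ b.stdIdeal i ↔ ¬ (b.IsD p ∧ b.src p = i) := basis_mem_sp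

theorem e_notMem_stdIdeal (i : Fin n) : e i ∉ b.stdIdeal i := by
  rw [← b.basis_triv, basis_mem_stdIdeal, not_not]
  exact ⟨isD_triv i, b.src_triv i⟩

theorem e_mul_mem_stdIdeal {i j : Fin n} (h : i < j) (a : A) : e j * a ∈ b.stdIdeal i := by
  refine sp_mono ?_ (e_mul_mem a j)
  rintro p rfl ⟨h1, rfl⟩
  exact absurd h1.tgt_le (not_le.2 h)

theorem mul_e_mem_stdIdeal {i j : Fin n} (h : j ≠ i) (a : A) : a * e j ∈ b.stdIdeal i := by
  refine sp_mono ?_ (mul_e_mem a j)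
  rintro p rfl ⟨-, h2⟩
  exact h h2

/-- Right multiplication by `e_i`, as a map `A → P_i`. -/
def toProj (e : Fin n → A) (i : Fin n) : A →ₗ[A] Proj e i :=
  (LinearMap.toSpanSingleton A A (e i)).codRestrict _ (fun a =>
    Submodule.smul_mem _ a (Submodule.mem_span_singleton_self _))

@[simp]
theorem coe_toProj (i : Fin n) (a : A) : (toProj e i a : A) = a * e i := rfl

theorem proj_mul_e (b : MonomialBasis k e P) {i : Fin n} (x : Proj e i) : (x : A) * e i = x := by
  obtain ⟨c, hc⟩ := Submodule.mem_span_singleton.1 x.2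
  rw [← hc, smul_eq_mul, mul_assoc, b.e_mul_self]

theorem toProj_coe (b : MonomialBasis k e P) {i : Fin n} (x : Proj e i) : toProj e i x = x :=
  Subtype.ext (b.proj_mul_e x)

/-- A path from `i` that is not a D-path visits some `j > i`, so it is a left multiple of an element
of `e_j P_i`. A path from another vertex is killed by `e_i`. -/
theorem toProj_mem {i : Fin n} {a : A} (ha : a ∈ b.stdIdeal i) : toProj e i a ∈ stdKernel e i := by
  refine sp_induction (C := fun a => toProj e i a ∈ stdKernel e i) ?_ ?_ ?_ ?_ ha
  · rw [map_zero]
    exact Submodule.zero_mem _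
  · intro x y hx hy
    rw [map_add]
    exact Submodule.add_mem _ hx hy
  · intro c x hx
    rw [Algebra.smul_def, ← smul_eq_mul, map_smul]
    exact Submodule.smul_mem _ _ hx
  · intro p hp
    by_cases hs : b.src p = i
    · have : ¬ b.IsD p := fun h => hp ⟨h, hs⟩
      simp only [IsD, not_forall, not_le] at this
      obtain ⟨q, r, h, hlt⟩ := this
      have h1 : toProj e i (b.basis p) = b.basis q • e (b.tgt r) • toProj e i (b.basis r) := by
        rw [← map_smul, ← map_smul, smul_eq_mul, smul_eq_mul, b.e_mul]
        exact congrArg _ h.symm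
      rw [h1]
      exact Submodule.smul_mem _ _ (Submodule.subset_span ⟨_, hs ▸ hlt, _, rfl⟩)
    · have h1 : toProj e i (b.basis p) = 0 :=
        Subtype.ext (by rw [coe_toProj, b.basis_mul_e, if_neg (Ne.symm hs)]; rfl)
      rw [h1]
      exact Submodule.zero_mem _

theorem mem_stdKernel {i : Fin n} (x : Proj e i) : x ∈ stdKernel e i ↔ (x : A) ∈ b.stdIdeal i := by
  constructor
  · intro hx
    have : stdKernel e i ≤ (b.stdIdeal i).comap (Proj e i).subtype := by
      rw [stdKernel, Submodule.span_le]
      rintro _ ⟨j, hj, y, rfl⟩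
      exact b.e_mul_mem_stdIdeal hj _
    exact this hx
  · intro hx
    rw [← b.toProj_coe x]
    exact b.toProj_mem hx

/-- The canonical map `A → Δ_i`. -/
def toStd (e : Fin n → A) (i : Fin n) : A →ₗ[A] Std e i := (stdKernel e i).mkQ ∘ₗ toProj e i

theorem toStd_mk (b : MonomialBasis k e P) {i : Fin n} (x : Proj e i) :
    toStd e i x = (stdKernel e i).mkQ x := by
  rw [toStd, LinearMap.comp_apply, b.toProj_coe]

theorem toStd_surjective (b : MonomialBasis k e P) (i : Fin n) :
    Function.Surjective (toStd e i) := by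
  intro y
  obtain ⟨x, rfl⟩ := (stdKernel e i).mkQ_surjective y
  exact ⟨x, b.toStd_mk x⟩

theorem mul_e_mem_iff {i : Fin n} {a : A} : a * e i ∈ b.stdIdeal i ↔ a ∈ b.stdIdeal i := by
  have h : a - a * e i ∈ b.stdIdeal i := by
    have h1 : a - a * e i = ∑ j ∈ Finset.univ.erase i, a * e j := by
      rw [Finset.sum_erase_eq_sub (Finset.mem_univ i), ← Finset.mul_sum, b.sum_e, mul_one]
    rw [h1]
    exact Submodule.sum_mem _ (fun j hj => b.mul_e_mem_stdIdeal (Finset.ne_of_mem_erase hj) a)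
  constructor
  · intro h'
    simpa using Submodule.add_mem _ h h'
  · intro h'
    simpa using Submodule.sub_mem _ h' h

theorem toStd_eq_zero {i : Fin n} {a : A} : toStd e i a = 0 ↔ a ∈ b.stdIdeal i := by
  rw [toStd, LinearMap.comp_apply, Submodule.mkQ_apply, Submodule.Quotient.mk_eq_zero,
    b.mem_stdKernel, coe_toProj, b.mul_e_mem_iff]

theorem ker_toStd (i : Fin n) : LinearMap.ker (toStd e i) = b.stdIdeal i := by
  ext a
  rw [LinearMap.mem_ker, b.toStd_eq_zero]

theorem e_smul_std (b : MonomialBasis k e P) {i j : Fin n} (h : i < j) (y : Std e i) :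
    e j • y = 0 := by
  obtain ⟨a, rfl⟩ := b.toStd_surjective i y
  rw [← map_smul, b.toStd_eq_zero]
  exact b.e_mul_mem_stdIdeal h a

theorem nontrivial_std (b : MonomialBasis k e P) (i : Fin n) : Nontrivial (Std e i) :=
  ⟨toStd e i (e i), 0, fun h => b.e_notMem_stdIdeal i (b.toStd_eq_zero.1 h)⟩

/-- If `l ≠ i`, then `char i` kills all multiples `c e_l a` but not `e_i`, whereas elements of
`stdIdeal i` have no coefficient at `e_i`. This fixes the label of a simple module from the standard
module that it induces. -/
theorem eq_of_generator (b : MonomialBasis k e P) {i l : Fin n} {g : Std e i}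
    (hg : Submodule.span A {g} = ⊤)
    (h : e l • g = g) : l = i := by
  by_contra hne
  obtain ⟨a, rfl⟩ := b.toStd_surjective i g
  have h1 : toStd e i (e i) ∈ Submodule.span A {toStd e i a} := hg ▸ Submodule.mem_top
  obtain ⟨c, hc⟩ := Submodule.mem_span_singleton.1 h1
  rw [← h, ← map_smul, ← map_smul, ← sub_eq_zero, ← map_sub, b.toStd_eq_zero,
    mem_stdIdeal, mem_sp] at hc
  refine hc (b.triv i) ?_ ⟨isD_triv i, b.src_triv i⟩
  rw [← char_apply, map_sub, smul_eq_mul, smul_eq_mul, map_mul, map_mul, char_e, char_e,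
    if_neg hne, if_pos rfl]
  simp

/-! ### Simple modules -/

/-- The kernel of `char i` on `P_i` is a maximal submodule. It is also contained in `rad(A) P_i`,
because the other characters vanish on `A e_i`. -/
theorem mem_jacobson_proj [Finite P] (b : MonomialBasis k e P) {i : Fin n} (x : Proj e i) :
    x ∈ Module.jacobson A (Proj e i) ↔ b.char i (x : A) = 0 := by
  constructor
  · intro hx
    let I : Submodule A A := RingHom.ker (b.char i)
    let N : Submodule A (Proj e i) := I.comap (Proj e i).subtype
    have hN : IsCoatom N := by
      refine ⟨fun h => ?_, fun N' hN' => ?_⟩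
      · have : toProj e i 1 ∈ N := h ▸ Submodule.mem_top
        have : b.char i (1 * e i) = 0 := this
        rw [one_mul, char_e, if_pos rfl] at this
        exact one_ne_zero this
      · obtain ⟨y, hy, hyN⟩ := Set.exists_of_ssubset hN'
        have hy0 : b.char i (y : A) ≠ 0 := hyN
        have h1 : toProj e i (e i - algebraMap k A (b.char i (y : A))⁻¹ * y) ∈ N := by
          change b.char i ((e i - algebraMap k A (b.char i (y : A))⁻¹ * y) * e i) = 0
          rw [map_mul, map_sub, map_mul, AlgHom.commutes, char_e, if_pos rfl]
          simp [hy0]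
        have h2 : toProj e i (e i) ∈ N' := by
          have h3 := N'.add_mem (hN'.le h1) (N'.smul_mem (algebraMap k A (b.char i (y : A))⁻¹) hy)
          have h4 : toProj e i (e i - algebraMap k A (b.char i (y : A))⁻¹ * y) +
              algebraMap k A (b.char i (y : A))⁻¹ • y = toProj e i (e i) := by
            have h5 := (toProj e i).map_smul (algebraMap k A (b.char i (y : A))⁻¹) (y : A)
            rw [b.toProj_coe] at h5
            rw [← h5, ← map_add, smul_eq_mul, sub_add_cancel]
          rwa [h4] at h3
        rw [eq_top_iff]
        intro z _
        have h5 : z = (z : A) • toProj e i (e i) := by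
          rw [← map_smul, smul_eq_mul, b.proj_mul_e, b.toProj_coe]
        rw [h5]
        exact N'.smul_mem _ h2
    have : Module.jacobson A (Proj e i) ≤ N := sInf_le hN
    exact this hx
  · intro hx
    refine Ring.jacobson_smul_top_le A (Proj e i) ?_
    have h1 : x = (x : A) • toProj e i (e i) := by
      rw [← map_smul, smul_eq_mul, b.proj_mul_e, b.toProj_coe]
    rw [h1]
    refine Submodule.smul_mem_smul ((b.mem_jacobson _).2 (fun j => ?_)) Submodule.mem_top
    by_cases hj : j = i
    · rw [hj, hx]
    · rw [← b.proj_mul_e x, map_mul, char_e, if_neg (Ne.symm hj), mul_zero]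

theorem nonempty_end_simp [Finite P] (b : MonomialBasis k e P) (i : Fin n) :
    Nonempty (Module.End A (Simp e i) ≃ₐ[k] k) := by
  refine nonempty_end_algEquiv ((Module.jacobson A (Proj e i)).mkQ (toProj e i 1)) ?_ ?_
  · rw [Submodule.mkQ_apply, Ne, Submodule.Quotient.mk_eq_zero, b.mem_jacobson_proj, coe_toProj,
      one_mul, char_e, if_pos rfl]
    exact one_ne_zero
  · intro m
    obtain ⟨x, rfl⟩ := (Module.jacobson A (Proj e i)).mkQ_surjective m
    refine ⟨b.char i (x : A), ?_⟩
    rw [← algebraMap_smul A (b.char i (x : A)), ← map_smul, ← sub_eq_zero, ← map_sub,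
      Submodule.mkQ_apply, Submodule.Quotient.mk_eq_zero, b.mem_jacobson_proj]
    rw [Submodule.coe_sub, Submodule.coe_smul, coe_toProj, one_mul, smul_eq_mul, map_sub,
      map_mul, AlgHom.commutes, char_e, if_pos rfl]
    simp

/-! ### Endomorphisms of standard modules -/

/-- Right multiplication by a nontrivial cyclic D-path at `i` induces a nilpotent endomorphism of
`Δ_i`. It is nonzero because it sends the class of `e_i` to the class of the cycle, but a field has
no nonzero nilpotents. -/
theorem noCycle_of_end [Finite P] (h : ∀ i, Nonempty (Module.End A (Std e i) ≃ₐ[k] k)) :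
    b.NoCycle := by
  intro p hD hp
  by_contra hl
  obtain ⟨φ⟩ := h (b.src p)
  -- If `q p` is a D-path from `i` and `p` is a cycle at `i`, then `q` is a D-path from `i`, so
  -- right multiplication by `p` descends to `Δ_i`.
  have hmul : ∀ a ∈ b.stdIdeal (b.src p), a * b.basis p ∈ b.stdIdeal (b.src p) := by
    intro a ha
    refine mul_mem_sp ?_ ha (basis_mem_sp.2 (Set.mem_singleton p))
    rintro q hq _ rfl r hr ⟨h1, h2⟩
    exact hq ⟨h1.left hr (hp.trans h2.symm), hr.src_eq.trans hp⟩
  let f : Module.End A (Std e (b.src p)) :=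
    (stdKernel e (b.src p)).liftQ
      (toStd e (b.src p) ∘ₗ LinearMap.toSpanSingleton A A (b.basis p) ∘ₗ (Proj e _).subtype) (by
        intro x hx
        rw [b.mem_stdKernel] at hx
        exact b.toStd_eq_zero.2 (hmul _ hx))
  have hf : ∀ a, f (toStd e _ a) = toStd e _ (a * b.basis p) := by
    intro a
    change toStd e _ (a * e _ * b.basis p) = _
    rw [mul_assoc, ← hp, b.e_mul]
  have hfm : ∀ m a, (f ^ m) (toStd e _ a) = toStd e _ (a * b.basis p ^ m) := by
    intro m
    induction m with
    | zero => simp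
    | succ m ih =>
      intro a
      rw [pow_succ, Module.End.mul_apply, hf, ih, mul_assoc, pow_succ']
  obtain ⟨m, hm⟩ := isNilpotent (b := b) (char_basis_of_len hl)
  have h0 : f ^ m = 0 := by
    ext y
    obtain ⟨a, ha⟩ := b.toStd_surjective _ ((stdKernel e (b.src p)).mkQ y)
    rw [LinearMap.comp_apply, ← ha, hfm, hm, mul_zero, map_zero, LinearMap.comp_apply,
      LinearMap.zero_apply]
  have h1 : φ f = 0 := by
    apply eq_zero_of_pow_eq_zero (n := m)
    rw [← map_pow, h0, map_zero]
  have h2 : f = 0 := φ.injective (h1.trans (map_zero φ).symm)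
  have h3 := hf (e (b.src p))
  rw [h2, LinearMap.zero_apply, ← hp, b.e_mul, hp] at h3
  exact b.basis_mem_stdIdeal.1 (b.toStd_eq_zero.1 h3.symm) ⟨hD, rfl⟩

end MonomialBasis

theorem finrank_le_of_le_sup {k V : Type*} [Field k] [AddCommGroup V] [Module k V]
    [Module.Finite k V] {U W : Submodule k V} {v : V} {p : Prop} [Decidable p]
    (h : W ≤ U ⊔ if p then Submodule.span k {v} else ⊥) :
    Module.finrank k W ≤ Module.finrank k U + if p then 1 else 0 := by
  refine (Submodule.finrank_mono h).trans
    ((Submodule.finrank_add_le_finrank_add_finrank _ _).trans (Nat.add_le_add_left ?_ _))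
  by_cases hp : p
  · rw [if_pos hp, if_pos hp]
    exact (finrank_span_le_card (R := k) ({v} : Set V)).trans (by simp)
  · simp [hp]

namespace MonomialBasis

variable {k : Type u} [Field k] {A : Type w} [Ring A] [Algebra k A] {n : ℕ}
  {e : Fin n → A} {P : Type x} (b : MonomialBasis k e P)

/-! ### Multiplicities in filtrations by standard modules -/

/-- The paths from `i` through vertices `≤ i`. -/
abbrev DFrom (i : Fin n) : Type x := {p : P // b.IsD p ∧ b.src p = i}

/-- The paths to `i` through vertices `≤ i`. -/
abbrev BTo (i : Fin n) : Type x := {p : P // b.IsB p ∧ b.tgt p = i}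

theorem finite_algebra [Finite P] (b : MonomialBasis k e P) : Module.Finite k A :=
  Module.Finite.of_basis b.basis

theorem finite_std [Finite P] (b : MonomialBasis k e P) (i : Fin n) :
    Module.Finite k (Std e i) :=
  have := b.finite_algebra
  Module.Finite.of_surjective ((toStd e i).restrictScalars k) (b.toStd_surjective i)

/-- The kernel of `A → Δ_i` is spanned by the remaining paths, so D-paths from `i` stay independent.
Only this inequality is needed for the count. -/
theorem card_DFrom_le [Finite P] (i : Fin n) : Nat.card (b.DFrom i) ≤ Module.finrank k (Std e i) := by
  have := b.finite_std i
  have := Fintype.ofFinite (b.DFrom i)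
  have h1 : LinearIndependent k (fun u : b.DFrom i => b.basis u) :=
    b.basis.linearIndependent.comp _ Subtype.val_injective
  have h2 := h1.map (f := (toStd e i).restrictScalars k) (by
    rw [Submodule.disjoint_def]
    intro a ha ha'
    have ha' : a ∈ b.stdIdeal i := b.toStd_eq_zero.1 ha'
    rw [mem_stdIdeal, mem_sp] at ha'
    have ha : a ∈ b.sp {p | b.IsD p ∧ b.src p = i} := by
      rw [sp, Set.image_eq_range]
      exact ha
    rw [mem_sp] at ha
    rw [← b.basis.repr.map_eq_zero_iff]
    ext p
    by_contra hp
    exact ha' p hp (ha p hp))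
  rw [Nat.card_eq_fintype_card]
  exact h2.fintype_card_le_finrank

/-- The coefficients of an element at the paths to `j` through vertices `≤ j`. -/
noncomputable def coeffB (j : Fin n) : A →ₗ[k] (b.BTo j → k) :=
  LinearMap.pi (fun c => b.basis.coord c)

theorem coeffB_surjective (j : Fin n) [Finite P] : Function.Surjective (b.coeffB j) := by
  classical
  intro f
  have := Fintype.ofFinite (b.BTo j)
  refine ⟨∑ c : b.BTo j, f c • b.basis c, ?_⟩
  ext d
  rw [coeffB, LinearMap.pi_apply, map_sum, Finset.sum_eq_single d]
  · simp
  · intro c _ hc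
    rw [map_smul, b.basis.coord_apply, b.basis.repr_self, Finsupp.single_eq_of_ne, smul_zero]
    exact fun h => hc (Subtype.ext h.symm)
  · simp

theorem coeffB_eq_zero {j : Fin n} {a : A} (h : a ∈ b.sp {p | ¬ (b.IsB p ∧ b.tgt p = j)}) :
    b.coeffB j a = 0 := by
  ext c
  by_contra hc
  exact mem_sp.1 h c hc c.2

/-- For a path `p` from `i`, only B-paths `p` ending at `j` affect these coefficients of `p g`. If
`i < j`, the product lies in `F` by assumption. If `i = j`, then `p` is a cyclic D-path, hence
trivial, and contributes `g`. -/
theorem coeffB_mul_mem {i j : Fin n} (hC : b.NoCycle) {g : A} (hg : e i * g = g)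
    {F : Submodule A A} (hF : ∀ p, b.src p = i → b.tgt p = j → i < j → b.basis p * g ∈ F) (a : A) :
    b.coeffB j (a * g) ∈ (F.restrictScalars k).map (b.coeffB j) ⊔
      (if i = j then Submodule.span k {b.coeffB j g} else ⊥) := by
  induction a using basis_induction (b := b) with
  | h0 => simp
  | hadd x y hx hy =>
    rw [add_mul, map_add]
    exact Submodule.add_mem _ hx hy
  | hsmul c x hx =>
    rw [smul_mul_assoc, map_smul]
    exact Submodule.smul_mem _ c hx
  | hb p =>
  by_cases hi : b.src p = i
  swap
  · rw [← hg, ← mul_assoc, b.basis_mul_e, if_neg (Ne.symm hi), zero_mul, map_zero]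
    exact Submodule.zero_mem _
  by_cases hp : b.IsB p ∧ b.tgt p = j
  swap
  · have h0 : b.coeffB j (b.basis p * g) = 0 := by
      refine b.coeffB_eq_zero
        (mul_mem_sp ?_ (basis_mem_sp.2 (Set.mem_singleton p)) (mem_sp_univ g))
      rintro _ rfl q - r hr ⟨h1, h2⟩
      exact hp ⟨h1.left hr, hr.tgt.symm.trans h2⟩
    rw [h0]
    exact Submodule.zero_mem _
  obtain ⟨h1, rfl⟩ := hp
  subst hi
  rcases h1.src_le.lt_or_eq with hlt | heq
  · exact Submodule.mem_sup_left (Submodule.mem_map_of_mem (hF p rfl rfl hlt))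
  · have hD : b.IsD p := fun q r h => (h1 q r h).trans_eq heq.symm
    have h0 := hC p hD heq.symm
    refine Submodule.mem_sup_right ?_
    have hb : b.basis p = e (b.src p) := by
      conv_lhs => rw [b.eq_triv p h0, b.basis_triv]
    rw [if_pos heq, hb, hg]
    exact Submodule.mem_span_singleton_self _

/-- A subquotient `Δ_i` adds at least the number of D-paths from `i` to the dimension. It adds at
most one dimension of coefficients at B-paths to `i`, and none at other targets, since `e_j Δ_i = 0`
for `j > i`. -/
theorem filtration_step [Finite P] (hC : b.NoCycle) {F G : Submodule A A} (hle : F ≤ G) {i : Fin n}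
    (φ : (G ⧸ F.submoduleOf G) ≃ₗ[A] Std e i) :
    Module.finrank k F + Nat.card (b.DFrom i) ≤ Module.finrank k G ∧
    ∀ j, Module.finrank k ((G.restrictScalars k).map (b.coeffB j)) ≤
      Module.finrank k ((F.restrictScalars k).map (b.coeffB j)) + if i = j then 1 else 0 := by
  have := b.finite_algebra
  let ψ : G →ₗ[A] Std e i := φ.toLinearMap ∘ₗ (F.submoduleOf G).mkQ
  have hψ : Function.Surjective ψ := φ.surjective.comp (Submodule.mkQ_surjective _)
  have hker : ∀ x : G, ψ x = 0 ↔ (x : A) ∈ F := by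
    intro x
    change φ _ = 0 ↔ _
    rw [φ.map_eq_zero_iff, Submodule.mkQ_apply, Submodule.Quotient.mk_eq_zero]
    rfl
  have hfG : Module.Finite k G := inferInstanceAs (Module.Finite k (G.restrictScalars k))
  constructor
  · have h1 := (ψ.restrictScalars k).finrank_range_add_finrank_ker
    rw [LinearMap.range_eq_top.2 (show Function.Surjective (ψ.restrictScalars k) from hψ),
      finrank_top] at h1
    have h2 : Module.finrank k F ≤ Module.finrank k (LinearMap.ker (ψ.restrictScalars k)) := by
      let ι : F →ₗ[k] LinearMap.ker (ψ.restrictScalars k) :=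
        ((Submodule.inclusion hle).restrictScalars k).codRestrict _
          (fun x => (hker (Submodule.inclusion hle x)).2 x.2)
      refine LinearMap.finrank_le_finrank_of_injective (f := ι) ?_
      intro x y hxy
      have h3 : Submodule.inclusion hle x = Submodule.inclusion hle y := congrArg Subtype.val hxy
      exact Submodule.inclusion_injective hle h3
    have h3 := b.card_DFrom_le i
    omega
  · intro j
    obtain ⟨g', hg'⟩ := hψ (toStd e i (e i))
    have hg : ψ (e i • g') = toStd e i (e i) := by
      rw [map_smul, hg', ← map_smul, smul_eq_mul, b.e_mul_self]
    have hle' : (G.restrictScalars k).map (b.coeffB j) ≤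
        (F.restrictScalars k).map (b.coeffB j) ⊔
          (if i = j then Submodule.span k {b.coeffB j (e i * g')} else ⊥) := by
      rintro _ ⟨x, hx, rfl⟩
      obtain ⟨a, ha⟩ := b.toStd_surjective i (ψ ⟨x, hx⟩)
      -- `e i * g'` lifts the generator of `Δ_i`, so subtracting a suitable multiple moves any
      -- element of `G` into `F`.
      have h1 : x - a * (e i * g') ∈ F := by
        refine (hker (⟨x, hx⟩ - a • e i • g')).1 ?_
        rw [map_sub, map_smul, hg, ← map_smul, ← ha, ← map_sub, b.toStd_eq_zero,
          ← b.mul_e_mem_iff, smul_eq_mul, sub_mul, mul_assoc, b.e_mul_self, sub_self]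
        exact Submodule.zero_mem _
      rw [show x = (x - a * (e i * g')) + a * (e i * g') by abel, map_add]
      refine Submodule.add_mem _ (Submodule.mem_sup_left (Submodule.mem_map_of_mem h1)) ?_
      refine b.coeffB_mul_mem hC (by rw [← mul_assoc, b.e_mul_self]) ?_ a
      intro p hp hp' hlt
      refine (hker (b.basis p • e i • g')).1 ?_
      rw [map_smul, hg, ← b.e_mul p, hp', mul_smul, b.e_smul_std hlt]
    exact finrank_le_of_le_sup hle'

/-- With `c j` the multiplicity of `Δ_j`, the filtration gives `|B_j| ≤ c j` and `∑ c j |D_j| ≤ dim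
A`. Hence there are no more pairs than paths, and the injection from paths to pairs given by cutting
is bijective. -/
theorem noRelation_of_filtration [Finite P] (hC : b.NoCycle) (hF : HasStdFiltration e A) :
    b.NoRelation := by
  classical
  have hfin := b.finite_algebra
  have := Fintype.ofFinite P
  obtain ⟨m, F, hF0, hFm, hstep⟩ := hF
  -- `c j` counts the occurrences of `Δ_j` among the first `l` subquotients.
  have key : ∀ l ≤ m, ∃ c : Fin n → ℕ,
      ∑ j, c j * Nat.card (b.DFrom j) ≤ Module.finrank k (F l) ∧
      ∀ j, Module.finrank k (((F l).restrictScalars k).map (b.coeffB j)) ≤ c j := by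
    intro l
    induction l with
    | zero =>
      intro _
      refine ⟨0, by simp, fun j => ?_⟩
      rw [hF0]
      have : ((⊥ : Submodule A A).restrictScalars k).map (b.coeffB j) = ⊥ := by
        rw [Submodule.restrictScalars_bot, Submodule.map_bot]
      rw [this]
      simp
    | succ l ih =>
      intro hl
      obtain ⟨c, hc, hc'⟩ := ih (by omega)
      obtain ⟨hle, i, ⟨φ⟩⟩ := hstep l (by omega)
      obtain ⟨h1, h2⟩ := b.filtration_step hC hle φ
      refine ⟨fun j => c j + if i = j then 1 else 0, ?_, fun j => ?_⟩
      · simp only [add_mul, Finset.sum_add_distrib, ite_mul, one_mul, zero_mul,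
          Finset.sum_ite_eq, Finset.mem_univ, if_true]
        omega
      · exact (h2 j).trans (Nat.add_le_add_right (hc' j) _)
  obtain ⟨c, hc, hc'⟩ := key m le_rfl
  rw [hFm] at hc hc'
  have hB : ∀ j, Nat.card (b.BTo j) ≤ c j := by
    intro j
    have h1 : ((⊤ : Submodule A A).restrictScalars k).map (b.coeffB j) = ⊤ := by
      rw [Submodule.restrictScalars_top, Submodule.map_top,
        LinearMap.range_eq_top.2 (b.coeffB_surjective j)]
    have h2 := hc' j
    rw [h1, finrank_top, Module.finrank_fintype_fun_eq_card] at h2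
    rwa [Nat.card_eq_fintype_card]
  have hA : Module.finrank k (⊤ : Submodule A A) = Fintype.card P := by
    rw [← Module.finrank_eq_card_basis b.basis]
    exact LinearEquiv.finrank_eq ((Submodule.topEquiv (R := A) (M := A)).restrictScalars k)
  have hcard : Fintype.card (Σ j, b.DFrom j × b.BTo j) ≤ Fintype.card P := by
    rw [Fintype.card_sigma, ← hA]
    refine le_trans (Finset.sum_le_sum fun j _ => ?_) hc
    rw [Fintype.card_prod, mul_comm, ← Nat.card_eq_fintype_card, ← Nat.card_eq_fintype_card]
    exact Nat.mul_le_mul_right _ (hB j)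
  choose u d hud hu hd using b.exists_fac_max
  let f : P → Σ j, b.DFrom j × b.BTo j :=
    fun w => ⟨b.src (u w), ⟨u w, hu w, rfl⟩, ⟨d w, hd w, (hud w).src_eq.symm⟩⟩
  have hpair : ∀ w, b.basis (f w).2.1 * b.basis (f w).2.2 = b.basis w := fun w => hud w
  have hinj : Function.Injective f := by
    intro w w' h
    apply b.basis.injective
    rw [← hpair w, ← hpair w', h]
  have hbij := (Fintype.bijective_iff_injective_and_card f).2
    ⟨hinj, le_antisymm (Fintype.card_le_of_injective f hinj) hcard⟩
  intro v t hv ht hvt h0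
  -- Surjectivity makes any composable pair the two parts of an actual path, whose basis vector is
  -- nonzero.
  obtain ⟨w, hw⟩ := hbij.2 ⟨b.src v, ⟨v, hv, rfl⟩, ⟨t, ht, hvt.symm⟩⟩
  have h1 := hpair w
  rw [hw] at h1
  exact basis_ne w (h1.symm.trans h0)

end MonomialBasis

/-! ### Induced modules -/

section Induced

variable {k : Type u} [Field k] {A : Type w} [Ring A] [Algebra k A] (B : Subalgebra k A)
  {M N : Type w} [AddCommGroup M] [Module B M] [AddCommGroup N] [Module B N]

/-- The element `a ⊗ m` of `A ⊗_B M`. -/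
def indTmul (a : A) (m : M) : Ind B M := (balancedRel B M).mkQ (a ⊗ₜ[ℤ] m)

theorem indTmul_mul (a : A) (c : B) (m : M) : indTmul B (a * c) m = indTmul B a (c • m) := by
  rw [← sub_eq_zero, indTmul, indTmul, ← map_sub, Submodule.mkQ_apply,
    Submodule.Quotient.mk_eq_zero]
  exact Submodule.subset_span ⟨a, c, m, rfl⟩

theorem indTmul_coe (c : B) (m : M) : indTmul B (c : A) m = indTmul B 1 (c • m) := by
  rw [← indTmul_mul, one_mul]

theorem smul_indTmul (a a' : A) (m : M) : a • indTmul B a' m = indTmul B (a * a') m := by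
  rw [indTmul, ← map_smul, TensorProduct.smul_tmul', smul_eq_mul, indTmul]

theorem indTmul_add (a : A) (m m' : M) :
    indTmul B a (m + m') = indTmul B a m + indTmul B a m' := by
  rw [indTmul, TensorProduct.tmul_add, map_add, indTmul, indTmul]

theorem add_indTmul (a a' : A) (m : M) :
    indTmul B (a + a') m = indTmul B a m + indTmul B a' m := by
  rw [indTmul, TensorProduct.add_tmul, map_add, indTmul, indTmul]

theorem indTmul_zero (a : A) : indTmul B a (0 : M) = 0 := by
  rw [indTmul, TensorProduct.tmul_zero, map_zero]

theorem zero_indTmul (m : M) : indTmul B 0 m = 0 := by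
  rw [indTmul, TensorProduct.zero_tmul, map_zero]

theorem sum_indTmul {ι : Type*} (s : Finset ι) (a : ι → A) (m : M) :
    indTmul B (∑ i ∈ s, a i) m = ∑ i ∈ s, indTmul B (a i) m := by
  rw [indTmul, TensorProduct.sum_tmul, map_sum]
  rfl

variable {B} in
theorem ind_induction {C : Ind B M → Prop} (h0 : C 0) (hadd : ∀ x y, C x → C y → C (x + y))
    (htmul : ∀ a m, C (indTmul B a m)) (y : Ind B M) : C y := by
  obtain ⟨x, rfl⟩ := (balancedRel B M).mkQ_surjective y
  induction x using TensorProduct.induction_on with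
  | zero => rwa [map_zero]
  | tmul a m => exact htmul a m
  | add x y hx hy =>
    rw [map_add]
    exact hadd _ _ hx hy

@[simp]
theorem indMap_indTmul (f : M →ₗ[B] N) (a : A) (m : M) :
    indMap B f (indTmul B a m) = indTmul B a (f m) := rfl

theorem indMap_surjective {f : M →ₗ[B] N} (hf : Function.Surjective f) :
    Function.Surjective (indMap B f) := by
  intro y
  induction y using ind_induction with
  | h0 => exact ⟨0, map_zero _⟩
  | hadd x y hx hy =>
    obtain ⟨x, rfl⟩ := hx
    obtain ⟨y, rfl⟩ := hy
    exact ⟨x + y, map_add _ _ _⟩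
  | htmul a m =>
    obtain ⟨m, rfl⟩ := hf m
    exact ⟨indTmul B a m, rfl⟩

theorem indMap_leftInverse {f : M →ₗ[B] N} {g : N →ₗ[B] M} (h : ∀ m, g (f m) = m) (y : Ind B M) :
    indMap B g (indMap B f y) = y := by
  induction y using ind_induction with
  | h0 => rw [map_zero, map_zero]
  | hadd x y hx hy => rw [map_add, map_add, hx, hy]
  | htmul a m => rw [indMap_indTmul, indMap_indTmul, h]

/-- Isomorphic modules induce isomorphic modules. -/
noncomputable def indCongr (f : M ≃ₗ[B] N) : Ind B M ≃ₗ[A] Ind B N :=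
  LinearEquiv.ofBijective (indMap B f.toLinearMap)
    ⟨Function.LeftInverse.injective (g := indMap B f.symm.toLinearMap)
      (indMap_leftInverse B f.symm_apply_apply), indMap_surjective B f.surjective⟩

/-- A `B`-linear map from `M` to an `A`-module induces an `A`-linear map on `A ⊗_B M`. -/
noncomputable def indLift {X : Type*} [AddCommGroup X] [Module A X] (h : M →ₗ[B] X) :
    Ind B M →ₗ[A] X :=
  (balancedRel B M).liftQ
    (TensorProduct.AlgebraTensorModule.lift
      (LinearMap.toSpanSingleton A (M →ₗ[ℤ] X) h.toAddMonoidHom.toIntLinearMap)) (by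
    rw [balancedRel, Submodule.span_le]
    rintro _ ⟨a, c, m, rfl⟩
    rw [SetLike.mem_coe, LinearMap.mem_ker, map_sub, sub_eq_zero]
    change (a * (c : A)) • h m = a • h (c • m)
    rw [map_smul, mul_smul]
    rfl)

@[simp]
theorem indLift_indTmul {X : Type*} [AddCommGroup X] [Module A X] (h : M →ₗ[B] X) (a : A) (m : M) :
    indLift B h (indTmul B a m) = a • h m := rfl

variable {B} in
-- Apply exactness to `0 → M → N`, with `PUnit` as the zero module in the right universe.
theorem IndExact.injective (hB : IndExact B) [Module.Finite B M] [Module.Finite B N]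
    {f : M →ₗ[B] N} (hf : Function.Injective f) : Function.Injective (indMap B f) := by
  rw [← LinearMap.ker_eq_bot, LinearMap.ker_eq_bot']
  intro x hx
  have h1 := hB PUnit.{w + 1} M N (0 : PUnit.{w + 1} →ₗ[B] M) f (by
    intro m
    constructor
    · intro hm
      exact ⟨0, by rw [map_zero]; exact (hf (hm.trans (map_zero f).symm)).symm⟩
    · rintro ⟨_, rfl⟩
      simp)
  obtain ⟨y, rfl⟩ := (h1 x).1 hx
  induction y using ind_induction with
  | h0 => exact map_zero _
  | hadd y z hy hz =>
    have hzero : ∀ t, indMap B (0 : PUnit.{w + 1} →ₗ[B] M) t = 0 := by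
      intro t
      induction t using ind_induction with
      | h0 => exact map_zero _
      | hadd y z hy hz => rw [map_add, hy, hz, add_zero]
      | htmul a m => exact indTmul_zero B a
    exact hzero _
  | htmul a m => exact indTmul_zero B a

/-- The multiplication `A ⊗_B B → A`. -/
noncomputable def indSelf : Ind B B →ₗ[A] A := indLift B (LinearMap.toSpanSingleton B A 1)

theorem indSelf_indTmul (a : A) (c : B) : indSelf B (indTmul B a c) = a * c := by
  rw [indSelf, indLift_indTmul, LinearMap.toSpanSingleton_apply, smul_eq_mul]
  change a * ((c : A) * 1) = _
  rw [mul_one]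

/-- Every tensor in `A ⊗_B B` has the form `a ⊗ 1`, and multiplication recovers `a`. -/
theorem indSelf_injective : Function.Injective (indSelf B) := by
  have h : ∀ y : Ind B B, y = indTmul B (indSelf B y) (1 : B) := by
    intro y
    induction y using ind_induction with
    | h0 => rw [map_zero, zero_indTmul]
    | hadd x y hx hy => rw [map_add, add_indTmul, ← hx, ← hy]
    | htmul a c => rw [indSelf_indTmul, indTmul_mul, smul_eq_mul, mul_one]
  intro y z hyz
  rw [h y, h z, hyz]

/-- The left ideal of `A` generated by a left ideal of `B`. -/
def extIdeal (I : Submodule B B) : Submodule A A := Submodule.span A {a | ∃ c ∈ I, (c : A) = a}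

/-- The map `A → A ⊗_B (B / I)`, `a ↦ a ⊗ 1`. -/
noncomputable def toIndQuot (I : Submodule B B) : A →ₗ[A] Ind B (B ⧸ I) :=
  LinearMap.toSpanSingleton A _ (indTmul B 1 (I.mkQ 1))

theorem toIndQuot_apply (I : Submodule B B) (a : A) :
    toIndQuot B I a = indTmul B a (I.mkQ 1) := by
  rw [toIndQuot, LinearMap.toSpanSingleton_apply, smul_indTmul, mul_one]

theorem toIndQuot_surjective (I : Submodule B B) : Function.Surjective (toIndQuot B I) := by
  intro y
  induction y using ind_induction with
  | h0 => exact ⟨0, map_zero _⟩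
  | hadd x y hx hy =>
    obtain ⟨x, rfl⟩ := hx
    obtain ⟨y, rfl⟩ := hy
    exact ⟨x + y, map_add _ _ _⟩
  | htmul a m =>
    obtain ⟨c, rfl⟩ := I.mkQ_surjective m
    refine ⟨a * c, ?_⟩
    rw [toIndQuot_apply, indTmul_mul, ← map_smul, smul_eq_mul, mul_one]

/-- This is `A ⊗_B (B / I) ≅ A / A I`. For the nontrivial inclusion, the map `B / I → A / A I`
induces a map on the tensor product that sends `a ⊗ 1` to the class of `a`. -/
theorem ker_toIndQuot (I : Submodule B B) : LinearMap.ker (toIndQuot B I) = extIdeal B I := by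
  apply le_antisymm
  · let h : (B ⧸ I) →ₗ[B] (A ⧸ extIdeal B I) :=
      I.liftQ (LinearMap.toSpanSingleton B (A ⧸ extIdeal B I) ((extIdeal B I).mkQ 1)) (by
        intro c hc
        rw [LinearMap.mem_ker, LinearMap.toSpanSingleton_apply]
        change (c : A) • (extIdeal B I).mkQ 1 = 0
        rw [← map_smul, smul_eq_mul, mul_one, Submodule.mkQ_apply, Submodule.Quotient.mk_eq_zero]
        exact Submodule.subset_span ⟨c, hc, rfl⟩)
    intro a ha
    have h1 : indLift B h (toIndQuot B I a) = 0 := by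
      rw [LinearMap.mem_ker.1 ha, map_zero]
    rw [toIndQuot_apply, indLift_indTmul] at h1
    change a • (1 : B) • (extIdeal B I).mkQ (1 : A) = 0 at h1
    rw [one_smul, ← map_smul, smul_eq_mul, mul_one, Submodule.mkQ_apply,
      Submodule.Quotient.mk_eq_zero] at h1
    exact h1
  · rw [extIdeal, Submodule.span_le]
    rintro _ ⟨c, hc, rfl⟩
    rw [SetLike.mem_coe, LinearMap.mem_ker, toIndQuot_apply, indTmul_coe, ← map_smul, smul_eq_mul,
      mul_one, Submodule.mkQ_apply, (Submodule.Quotient.mk_eq_zero I).2 hc, indTmul_zero]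

end Induced

namespace MonomialBasis

variable {k : Type u} [Field k] {A : Type w} [Ring A] [Algebra k A] {n : ℕ}
  {e : Fin n → A} {P : Type x} (b : MonomialBasis k e P) (B : Subalgebra k A)

/-! ### Simple modules over subalgebras that contain the trivial paths -/

/-- The restriction of a character to a subalgebra. -/
noncomputable def subChar (i : Fin n) : B →ₐ[k] k := (b.char i).comp B.val

/-- The kernel of a character of a subalgebra, as a left ideal. -/
noncomputable def maxIdeal (i : Fin n) : Submodule B B := RingHom.ker (b.subChar B i)

theorem mem_maxIdeal {i : Fin n} {c : B} : c ∈ b.maxIdeal B i ↔ b.char i (c : A) = 0 := Iff.rfl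

theorem mem_jacobson_subalgebra [Finite P] (c : B) :
    c ∈ Ring.jacobson B ↔ ∀ i, b.char i (c : A) = 0 := by
  refine mem_jacobson_iff_characters (b.subChar B) (fun c hc => ?_) c
  obtain ⟨m, hm⟩ := isNilpotent (b := b) (a := c) hc
  exact ⟨m, Subtype.ext hm⟩

instance isSimpleModule_quotient (i : Fin n) : IsSimpleModule B (B ⧸ b.maxIdeal B i) :=
  isSimpleModule_iff_isCoatom.2 (isCoatom_ker (b.subChar B i))

variable {B}

/-- Some `e_i m` is nonzero and generates `M`. The radical of `B` kills `M`, so the annihilator of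
`e_i m` contains the maximal left ideal at `i` and equals it. -/
theorem exists_equiv_of_isSimpleModule [Finite P] (hB : ∀ i, e i ∈ B) (M : Type w) [AddCommGroup M]
    [Module B M] [IsSimpleModule B M] : ∃ i, Nonempty (M ≃ₗ[B] (B ⧸ b.maxIdeal B i)) := by
  have := IsSimpleModule.nontrivial B M
  obtain ⟨m, hm⟩ := exists_ne (0 : M)
  have h1 : ∃ i, (⟨e i, hB i⟩ : B) • m ≠ 0 := by
    by_contra! h
    apply hm
    have h2 : (1 : B) = ∑ i, (⟨e i, hB i⟩ : B) := by
      apply Subtype.ext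
      rw [AddSubmonoidClass.coe_finsetSum]
      exact b.sum_e.symm
    rw [← one_smul B m, h2, Finset.sum_smul]
    exact Finset.sum_eq_zero (fun i _ => h i)
  obtain ⟨i, hi⟩ := h1
  set y := (⟨e i, hB i⟩ : B) • m with hy
  have hey : (⟨e i, hB i⟩ : B) • y = y := by
    rw [hy, ← mul_smul]
    congr 1
    exact Subtype.ext (b.e_mul_self i)
  have hsurj : Function.Surjective (LinearMap.toSpanSingleton B M y) :=
    IsSimpleModule.toSpanSingleton_surjective B hi
  have hjac : ∀ c ∈ Ring.jacobson B, ∀ z : M, c • z = 0 := by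
    intro c hc z
    have h2 := Ring.jacobson_smul_top_le B M (Submodule.smul_mem_smul hc (Submodule.mem_top (x := z)))
    have h3 : Module.jacobson B M ≤ ⊥ := sInf_le isCoatom_bot
    exact (Submodule.mem_bot B).1 (h3 h2)
  have hker : LinearMap.ker (LinearMap.toSpanSingleton B M y) = b.maxIdeal B i := by
    have hle : b.maxIdeal B i ≤ LinearMap.ker (LinearMap.toSpanSingleton B M y) := by
      intro c hc
      rw [LinearMap.mem_ker, LinearMap.toSpanSingleton_apply, ← hey, ← mul_smul]
      refine hjac _ ((b.mem_jacobson_subalgebra B _).2 (fun j => ?_)) y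
      change b.char j ((c : A) * e i) = 0
      rw [map_mul, char_e]
      split_ifs with h
      · rw [← h, (b.mem_maxIdeal B).1 hc, zero_mul]
      · rw [mul_zero]
    refine ((isCoatom_ker (b.subChar B i)).le_iff.1 hle).resolve_left (fun h => ?_)
    have h4 : (1 : B) ∈ LinearMap.ker (LinearMap.toSpanSingleton B M y) := h ▸ Submodule.mem_top
    rw [LinearMap.mem_ker, LinearMap.toSpanSingleton_apply, one_smul] at h4
    exact hi h4
  exact ⟨i, ⟨((Submodule.quotEquivOfEq _ _ hker).symm.trans
    ((LinearMap.toSpanSingleton B M y).quotKerEquivOfSurjective hsurj)).symm⟩⟩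

theorem one_sub_e_mem (hB : ∀ i, e i ∈ B) (i : Fin n) : (1 - ⟨e i, hB i⟩ : B) ∈ b.maxIdeal B i := by
  rw [mem_maxIdeal]
  change b.char i (1 - e i) = 0
  rw [map_sub, map_one, char_e, if_pos rfl, sub_self]

theorem e_smul_mkQ_one (hB : ∀ i, e i ∈ B) (i : Fin n) :
    (⟨e i, hB i⟩ : B) • (b.maxIdeal B i).mkQ 1 = (b.maxIdeal B i).mkQ 1 := by
  rw [← map_smul, eq_comm, ← sub_eq_zero, ← map_sub, smul_eq_mul, mul_one,
    Submodule.mkQ_apply, Submodule.Quotient.mk_eq_zero]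
  exact b.one_sub_e_mem hB i

theorem eq_of_equiv (hB : ∀ i, e i ∈ B) {i j : Fin n}
    (φ : (B ⧸ b.maxIdeal B i) ≃ₗ[B] (B ⧸ b.maxIdeal B j)) : i = j := by
  by_contra hij
  have h1 : (b.maxIdeal B i).mkQ 1 ≠ 0 := by
    rw [Submodule.mkQ_apply, Ne, Submodule.Quotient.mk_eq_zero, mem_maxIdeal]
    change b.char i 1 ≠ 0
    rw [map_one]
    exact one_ne_zero
  apply h1
  rw [← φ.map_eq_zero_iff, ← b.e_smul_mkQ_one hB, map_smul]
  obtain ⟨c, hc⟩ := (b.maxIdeal B j).mkQ_surjective (φ ((b.maxIdeal B i).mkQ 1))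
  rw [← hc, ← map_smul, Submodule.mkQ_apply, Submodule.Quotient.mk_eq_zero, mem_maxIdeal]
  change b.char j (e i * c) = 0
  rw [map_mul, char_e, if_neg hij, zero_mul]

theorem eq_of_ind_equiv (hB : ∀ i, e i ∈ B) {l i : Fin n}
    (φ : Ind B (B ⧸ b.maxIdeal B l) ≃ₗ[A] Std e i) : l = i := by
  refine b.eq_of_generator (g := φ (toIndQuot B _ 1)) ?_ ?_
  · rw [eq_top_iff]
    intro y _
    obtain ⟨a, ha⟩ := toIndQuot_surjective B (b.maxIdeal B l) (φ.symm y)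
    refine Submodule.mem_span_singleton.2 ⟨a, ?_⟩
    rw [← map_smul, ← map_smul, smul_eq_mul, mul_one, ha, LinearEquiv.apply_symm_apply]
  · rw [← map_smul, toIndQuot_apply, smul_indTmul, mul_one]
    have := indTmul_coe B (⟨e l, hB l⟩ : B) ((b.maxIdeal B l).mkQ 1)
    rw [b.e_smul_mkQ_one hB] at this
    exact congrArg φ this

/-- The simple modules over an exact Borel subalgebra that contains the trivial paths induce the
standard modules. -/
theorem nonempty_ind_equiv [Finite P] (hB : ∀ i, e i ∈ B) (h : IsExactBorel B e) (i : Fin n) :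
    Nonempty (Ind B (B ⧸ b.maxIdeal B i) ≃ₗ[A] Std e i) := by
  obtain ⟨-, S, hS, -, -, hind, -⟩ := h
  have := hS i
  obtain ⟨l, ⟨φ⟩⟩ := b.exists_equiv_of_isSimpleModule hB (S i)
  obtain ⟨ψ⟩ := hind i
  have hl := b.eq_of_ind_equiv hB ((indCongr B φ).symm.trans ψ)
  subst hl
  exact ⟨(indCongr B φ).symm.trans ψ⟩

/-- The given isomorphism need not match the canonical map `A → Δ_i`. Its composite with `A → A ⊗_B
S_i` still kills `stdIdeal i`, because `e_j Δ_i = 0` for `j > i` and the other idempotents lie in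
the maximal ideal. Equality follows by dimension. -/
theorem extIdeal_eq [Finite P] (hB : ∀ i, e i ∈ B) {i : Fin n}
    (φ : Ind B (B ⧸ b.maxIdeal B i) ≃ₗ[A] Std e i) :
    extIdeal B (b.maxIdeal B i) = b.stdIdeal i := by
  have := b.finite_algebra
  let θ : A →ₗ[A] Std e i := φ.toLinearMap ∘ₗ toIndQuot B (b.maxIdeal B i)
  have hθ : Function.Surjective θ := φ.surjective.comp (toIndQuot_surjective B _)
  have hker : LinearMap.ker θ = extIdeal B (b.maxIdeal B i) := by
    rw [← ker_toIndQuot]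
    ext a
    exact φ.map_eq_zero_iff
  have hle : b.stdIdeal i ≤ LinearMap.ker θ := by
    intro a ha
    refine sp_induction (C := fun a => a ∈ LinearMap.ker θ) ?_ ?_ ?_ ?_ ha
    · exact Submodule.zero_mem _
    · exact fun x y hx hy => Submodule.add_mem _ hx hy
    · intro c x hx
      rw [Algebra.smul_def]
      exact Submodule.smul_mem _ _ hx
    · intro p hp
      by_cases hs : b.src p = i
      · have : ¬ b.IsD p := fun h => hp ⟨h, hs⟩
        simp only [IsD, not_forall, not_le] at this
        obtain ⟨q, r, h, hlt⟩ := this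
        have h1 : b.basis p = b.basis q • e (b.tgt r) • b.basis r := by
          rw [smul_eq_mul, smul_eq_mul, b.e_mul]
          exact h.symm
        rw [LinearMap.mem_ker, h1, map_smul, map_smul, b.e_smul_std (hs ▸ hlt), smul_zero]
      · rw [← b.mul_e p, hker]
        refine Submodule.smul_mem _ (b.basis p) (Submodule.subset_span ⟨⟨e _, hB _⟩, ?_, rfl⟩)
        rw [mem_maxIdeal]
        change b.char i (e _) = 0
        rw [char_e, if_neg hs]
  have h1 := (θ.restrictScalars k).finrank_range_add_finrank_ker
  have h2 := ((toStd e i).restrictScalars k).finrank_range_add_finrank_ker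
  rw [LinearMap.range_eq_top.2 (show Function.Surjective (θ.restrictScalars k) from hθ)] at h1
  rw [LinearMap.range_eq_top.2
    (show Function.Surjective ((toStd e i).restrictScalars k) from b.toStd_surjective i)] at h2
  have h3 : LinearMap.ker ((toStd e i).restrictScalars k) ≤ LinearMap.ker (θ.restrictScalars k) := by
    intro a ha
    exact hle (b.toStd_eq_zero.1 ha)
  have h4 := Submodule.eq_of_le_of_finrank_eq h3 (by omega)
  rw [← hker]
  refine le_antisymm (fun a ha => ?_) hle
  have h5 : a ∈ LinearMap.ker (θ.restrictScalars k) := ha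
  rw [← h4] at h5
  exact b.toStd_eq_zero.1 h5

/-! ### Exact Borel subalgebras that contain another one -/

/-- A Nakayama-type argument through induction. If the elements of `B'` did not generate, they would
vanish in a simple quotient of the left ideal. Since they generate its extension to `A`, that
quotient would induce zero, not some `Δ_l`. -/
theorem maxIdeal_le_span [Finite P] {B' : Subalgebra k A} (hB' : ∀ i, e i ∈ B') (hle : B' ≤ B)
    (hexact : IndExact B)
    (hstd : ∀ i, Nonempty (Ind B (B ⧸ b.maxIdeal B i) ≃ₗ[A] Std e i)) {i : Fin n}
    (hext : extIdeal B (b.maxIdeal B i) ≤ extIdeal B' (b.maxIdeal B' i)) :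
    b.maxIdeal B i ≤ Submodule.span B {d : B | (d : A) ∈ B' ∧ b.char i (d : A) = 0} := by
  have hfin := b.finite_algebra
  have hB : ∀ i, e i ∈ B := fun i => hle (hB' i)
  have hnoeth : IsNoetherian B B := by
    have : IsNoetherian k B := inferInstanceAs (IsNoetherian k (Subalgebra.toSubmodule B))
    exact isNoetherian_of_tower k this
  set N := Submodule.span B {d : B | (d : A) ∈ B' ∧ b.char i (d : A) = 0} with hN
  have hfinR : Module.Finite B (b.maxIdeal B i) := Module.IsNoetherian.finite B _
  rw [← Submodule.comap_subtype_eq_top]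
  by_contra hne
  obtain ⟨N', hN', hNN'⟩ := (eq_top_or_exists_le_coatom _).resolve_left hne
  have hsimple : IsSimpleModule B (b.maxIdeal B i ⧸ N') := isSimpleModule_iff_isCoatom.2 hN'
  obtain ⟨l, ⟨φ⟩⟩ := b.exists_equiv_of_isSimpleModule hB (b.maxIdeal B i ⧸ N')
  obtain ⟨ψ⟩ := hstd l
  have hzero : ∀ t, indMap B N'.mkQ t = 0 := by
    -- Each element of the extended ideal of `B'` is the image of a tensor built from generators in
    -- `B'`, which the projection to the simple quotient kills.
    have hlift : ∀ y ∈ extIdeal B' (b.maxIdeal B' i), ∃ t : Ind B (b.maxIdeal B i),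
        indSelf B (indMap B (b.maxIdeal B i).subtype t) = y ∧ indMap B N'.mkQ t = 0 := by
      intro y hy
      refine Submodule.span_induction ?_ ?_ ?_ ?_ hy
      · rintro _ ⟨d, hd, rfl⟩
        have hd' : (⟨d, hle d.2⟩ : B) ∈ b.maxIdeal B i := hd
        refine ⟨indTmul B 1 ⟨⟨d, hle d.2⟩, hd'⟩, ?_, ?_⟩
        · rw [indMap_indTmul, indSelf_indTmul, one_mul]
          rfl
        · rw [indMap_indTmul, Submodule.mkQ_apply, (Submodule.Quotient.mk_eq_zero N').2,
            indTmul_zero]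
          apply hNN'
          exact Submodule.subset_span (s := {d : B | (d : A) ∈ B' ∧ b.char i (d : A) = 0}) ⟨d.2, hd⟩
      · exact ⟨0, by rw [map_zero, map_zero], map_zero _⟩
      · rintro _ _ - - ⟨t, rfl, ht⟩ ⟨t', rfl, ht'⟩
        exact ⟨t + t', by rw [map_add, map_add], by rw [map_add, ht, ht', add_zero]⟩
      · rintro a _ - ⟨t, rfl, ht⟩
        exact ⟨a • t, by rw [map_smul, map_smul], by rw [map_smul, ht, smul_zero]⟩
    intro t
    induction t using ind_induction with
    | h0 => exact map_zero _
    | hadd x y hx hy => rw [map_add, hx, hy, add_zero]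
    | htmul a r =>
      have h1 : a * ((r : B) : A) ∈ extIdeal B (b.maxIdeal B i) :=
        Submodule.smul_mem _ a (Submodule.subset_span ⟨r, r.2, rfl⟩)
      obtain ⟨t, ht, ht'⟩ := hlift _ (hext h1)
      -- Exactness embeds `A ⊗_B` of the ideal into `A ⊗_B B ≅ A`, so two tensors with the same
      -- product coincide.
      have h2 : t = indTmul B a r := by
        refine hexact.injective (Submodule.subtype_injective (b.maxIdeal B i)) ?_
        refine indSelf_injective B ?_
        rw [ht, indMap_indTmul, indSelf_indTmul]
        rfl
      rw [← h2, ht']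
  have hnt := b.nontrivial_std l
  obtain ⟨y, hy⟩ := exists_ne (0 : Std e l)
  obtain ⟨t, ht⟩ := indMap_surjective B N'.mkQ_surjective ((indCongr B φ).symm (ψ.symm y))
  rw [hzero, eq_comm, LinearEquiv.map_eq_zero_iff, LinearEquiv.map_eq_zero_iff] at ht
  exact hy ht

/-- By induction on `m`, every element of `B` lies in `B'` modulo paths of length at least `m`:
radical generators from `B'` raise the length of the error term by one. For large `m` no error is
left. -/
theorem eq_of_le [Finite P] {B' : Subalgebra k A} (hB' : ∀ i, e i ∈ B') (hle : B' ≤ B)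
    (hexact : IndExact B)
    (hstd : ∀ i, Nonempty (Ind B (B ⧸ b.maxIdeal B i) ≃ₗ[A] Std e i))
    (hext : ∀ i, extIdeal B (b.maxIdeal B i) ≤ extIdeal B' (b.maxIdeal B' i)) : B = B' := by
  have key : ∀ m, ∀ c ∈ B, c ∈ Subalgebra.toSubmodule B' ⊔ b.sp {p | m ≤ b.len p} := by
    intro m
    induction m with
    | zero =>
      intro c _
      exact Submodule.mem_sup_right (by simpa using mem_sp_univ (b := b) c)
    | succ m ih =>
      -- The left factor `c` is kept arbitrary to absorb the coefficients in the `B`-span during the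
      -- induction.
      have h1 : ∀ i, ∀ x ∈ b.maxIdeal B i, ∀ c ∈ B,
          c * (x * e i) ∈ Subalgebra.toSubmodule B' ⊔ b.sp {p | m + 1 ≤ b.len p} := by
        intro i x hx
        have hx' := b.maxIdeal_le_span hB' hle hexact hstd (hext i) hx
        refine Submodule.span_induction (p := fun (x : B) _ => ∀ c ∈ B,
          c * ((x : A) * e i) ∈ Subalgebra.toSubmodule B' ⊔ b.sp {p | m + 1 ≤ b.len p})
          ?_ ?_ ?_ ?_ hx'
        · rintro d ⟨hd, hd'⟩ c hc
          obtain ⟨c', hc', s, hs, rfl⟩ := Submodule.mem_sup.1 (ih c hc)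
          rw [add_mul]
          refine Submodule.add_mem_sup (B'.mul_mem hc' (B'.mul_mem hd (hB' i))) ?_
          refine mul_mem_sp ?_ hs (mem_sp_len_pos.2 fun j => ?_)
          · intro p hp q hq r hr
            have := hr.len
            simp only [Set.mem_ofPred_eq] at *
            omega
          · rw [map_mul, char_e]
            split_ifs with h
            · rw [← h, hd', zero_mul]
            · rw [mul_zero]
        · intro c _
          simp
        · intro x y _ _ hx hy c hc
          rw [Subalgebra.coe_add, add_mul, mul_add]
          exact Submodule.add_mem _ (hx c hc) (hy c hc)
        · intro a x _ hx c hc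
          rw [smul_eq_mul, Subalgebra.coe_mul, mul_assoc, ← mul_assoc]
          exact hx _ (B.mul_mem hc a.2)
      intro c hc
      have hsum : ∑ i, b.char i c • e i ∈ B' :=
        B'.sum_mem (fun i _ => B'.smul_mem (hB' i) _)
      have h2 : c = ∑ i, b.char i c • e i +
          ∑ i, 1 * ((c - ∑ j, b.char j c • e j) * e i) := by
        simp only [one_mul]
        rw [← Finset.mul_sum, b.sum_e, mul_one]
        abel
      rw [h2]
      refine Submodule.add_mem _ (Submodule.mem_sup_left hsum) (Submodule.sum_mem _ fun i _ => ?_)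
      exact h1 i ⟨c - ∑ j, b.char j c • e j, B.sub_mem hc (hle hsum)⟩ (b.sub_sum_mem c i) 1
        B.one_mem
  obtain ⟨N, hN⟩ := b.sp_len_eq_bot
  refine le_antisymm (fun c hc => ?_) hle
  obtain ⟨c', hc', s, hs, rfl⟩ := Submodule.mem_sup.1 (key N c hc)
  rw [hN s hs, add_zero]
  exact hc'

end MonomialBasis

/-! ### Vanishing of `Ext¹` for a cyclic module -/

section Extensions

open CategoryTheory

/-- In the long exact sequence of `0 → I → S → S / I → 0`, projectivity of `S` makes every extension
class come from a map `I → T`. Maps that extend to `S` give zero. -/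
theorem subsingleton_ext_one {S : Type w} [Ring S] (I : Submodule S S) (T : Type w) [AddCommGroup T]
    [Module S T] (h : ∀ f : I →ₗ[S] T, ∃ g : S →ₗ[S] T, ∀ c : I, g c = f c) :
    Subsingleton (Abelian.Ext.{w} (ModuleCat.of S (S ⧸ I)) (ModuleCat.of S T) 1) := by
  have hS := LinearMap.shortExact_shortComplexKer (f := I.mkQ) I.mkQ_surjective
  have : Projective (I.mkQ.shortComplexKer).X₂ :=
    inferInstanceAs (Projective (ModuleCat.of S S))
  refine subsingleton_of_forall_eq 0 (fun y => ?_)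
  obtain ⟨z, rfl⟩ := Abelian.Ext.contravariant_sequence_exact₃ hS (ModuleCat.of S T) y
    (Abelian.Ext.eq_zero_of_projective _) (add_comm 1 0)
  obtain ⟨f, rfl⟩ := Abelian.Ext.homEquiv₀.symm.surjective z
  obtain ⟨g, hg⟩ := h (f.hom ∘ₗ (LinearEquiv.ofEq _ _ I.ker_mkQ.symm).toLinearMap)
  have hfg : f = I.mkQ.shortComplexKer.f ≫ ModuleCat.ofHom g := by
    ext c
    exact (hg (LinearEquiv.ofEq _ _ I.ker_mkQ c)).symm
  subst hfg
  change hS.extClass.comp (Abelian.Ext.mk₀ _) _ = 0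
  rw [← Abelian.Ext.mk₀_comp_mk₀, ShortComplex.ShortExact.extClass_comp_assoc]

end Extensions

namespace MonomialBasis

variable {k : Type u} [Field k] {A : Type w} [Ring A] [Algebra k A] {n : ℕ}
  {e : Fin n → A} {P : Type x} (b : MonomialBasis k e P)

/-! ### The subalgebra spanned by the paths whose target is a maximal vertex -/

theorem one_mem_sp_isB (b : MonomialBasis k e P) : (1 : A) ∈ b.sp {p | b.IsB p} := by
  rw [← b.sum_e]
  refine Submodule.sum_mem _ (fun i _ => ?_)
  rw [← b.basis_triv]
  exact basis_mem_sp.2 (isB_triv i)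

/-- The span of all paths that pass only through vertices that are at most their target. -/
noncomputable def borel : Subalgebra k A :=
  (b.sp {p | b.IsB p}).toSubalgebra b.one_mem_sp_isB
    (fun _ _ hx hy => mul_mem_sp (fun _ hp _ hq _ hr => IsB.mul hr hp hq) hx hy)

theorem basis_mem_borel {p : P} : b.basis p ∈ b.borel ↔ b.IsB p := basis_mem_sp

theorem e_mem_borel (b : MonomialBasis k e P) (i : Fin n) : e i ∈ b.borel := by
  rw [← b.basis_triv, basis_mem_borel]
  exact isB_triv i

/-- The final part of a path, starting at its maximal vertex. -/
noncomputable def dPart (p : P) : P := (b.exists_fac_max p).choose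

/-- The initial part of a path, ending at its maximal vertex. -/
noncomputable def bPart (p : P) : P := (b.exists_fac_max p).choose_spec.choose

theorem fac_parts (p : P) : b.Fac p (b.dPart p) (b.bPart p) :=
  (b.exists_fac_max p).choose_spec.choose_spec.1

theorem isD_dPart (p : P) : b.IsD (b.dPart p) :=
  (b.exists_fac_max p).choose_spec.choose_spec.2.1

theorem isB_bPart (p : P) : b.IsB (b.bPart p) :=
  (b.exists_fac_max p).choose_spec.choose_spec.2.2

open scoped Classical in
/-- The coordinates of a dual basis of `A` as a right module over `borel`. -/
noncomputable def dualCoord (u : P) : A →ₗ[k] b.borel :=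
  b.basis.constr k (fun p => if b.dPart p = u then
    ⟨b.basis (b.bPart p), b.basis_mem_borel.2 (b.isB_bPart p)⟩ else 0)

open scoped Classical in
theorem dualCoord_basis (u p : P) : (b.dualCoord u (b.basis p) : A) =
    if b.dPart p = u then b.basis (b.bPart p) else 0 := by
  rw [dualCoord, Module.Basis.constr_basis]
  split_ifs <;> rfl

/-- Multiplying `p` on the right by a B-path `q` keeps its D-part and turns its B-part `c` into `c
q`. If `p q = 0`, then `c q = 0`, since otherwise `NoRelation` would make the whole product nonzero.
-/
theorem dualCoord_mul (hC : b.NoCycle) (hH : b.NoRelation) (u : P) (a : A) (c : b.borel) :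
    b.dualCoord u (a * c) = b.dualCoord u a * c := by
  classical
  obtain ⟨c, hc⟩ := c
  apply Subtype.ext
  change (b.dualCoord u (a * c) : A) = b.dualCoord u a * c
  refine sp_induction (C := fun c => (b.dualCoord u (a * c) : A) = b.dualCoord u a * c)
    ?_ ?_ ?_ ?_ hc
  · simp
  · intro x y hx hy
    rw [mul_add, map_add, Subalgebra.coe_add, hx, hy, mul_add]
  · intro t x hx
    rw [mul_smul_comm, map_smul, Subalgebra.coe_smul, hx, mul_smul_comm]
  intro q hq
  induction a using basis_induction (b := b) with
  | h0 => simp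
  | hadd x y hx hy => rw [add_mul, map_add, map_add, Subalgebra.coe_add, hx, hy,
      Subalgebra.coe_add, add_mul]
  | hsmul t x hx => rw [smul_mul_assoc, map_smul, map_smul, Subalgebra.coe_smul, hx,
      Subalgebra.coe_smul, smul_mul_assoc]
  | hb p =>
  have hp := b.fac_parts p
  rcases b.mul_eq p q with h0 | ⟨r, hr⟩
  · rw [h0, map_zero, dualCoord_basis]
    have h1 : b.basis (b.bPart p) * b.basis q = 0 := by
      by_contra hne
      obtain ⟨d, hd⟩ := exists_fac hne
      refine hH _ d (b.isD_dPart p) ((b.isB_bPart p).mul hd hq) ?_ ?_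
      · rw [hp.src_eq, hd.tgt]
      · rw [← hd, ← mul_assoc, hp, h0]
    split_ifs
    · rw [h1]
      rfl
    · rw [zero_mul]
      rfl
  · obtain ⟨d, hd, hd'⟩ := Fac.assoc_right (b := b) hr hp
    obtain ⟨h1, h2⟩ := fac_max_unique hC hd (b.fac_parts r) (b.isD_dPart p) (b.isD_dPart r)
      ((b.isB_bPart p).mul hd' hq) (b.isB_bPart r)
    rw [hr, dualCoord_basis, dualCoord_basis, ← h1, ← h2]
    split_ifs
    · exact hd'.symm
    · rw [zero_mul]

theorem sum_dualCoord [Fintype P] (a : A) :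
    ∑ u, b.basis u * (b.dualCoord u a : A) = a := by
  classical
  induction a using basis_induction (b := b) with
  | h0 => simp
  | hadd x y hx hy =>
    simp only [map_add, Subalgebra.coe_add, mul_add, Finset.sum_add_distrib, hx, hy]
  | hsmul t x hx =>
    simp only [map_smul, Subalgebra.coe_smul, mul_smul_comm, ← Finset.smul_sum, hx]
  | hb p =>
    simp only [dualCoord_basis, mul_ite, mul_zero]
    rw [Finset.sum_ite_eq, if_pos (Finset.mem_univ _)]
    exact b.fac_parts p

section Coordinates

variable {M N : Type w} [AddCommGroup M] [Module b.borel M] [AddCommGroup N] [Module b.borel N]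

/-- The coordinates of `A ⊗ M`. -/
noncomputable def tensorCoord (M : Type w) [AddCommGroup M] [Module b.borel M] (u : P) :
    A ⊗[ℤ] M →+ M :=
  TensorProduct.liftAddHom ((smulAddHom b.borel M).comp (b.dualCoord u).toAddMonoidHom) (by
    intro r a m
    change b.dualCoord u (r • a) • m = b.dualCoord u a • (r • m)
    rw [map_zsmul, smul_assoc, smul_comm])

@[simp]
theorem tensorCoord_tmul (u : P) (a : A) (m : M) :
    b.tensorCoord M u (a ⊗ₜ[ℤ] m) = b.dualCoord u a • m := rfl

theorem tensorCoord_balancedRel (hC : b.NoCycle) (hH : b.NoRelation) (u : P) {y : A ⊗[ℤ] M}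
    (hy : y ∈ balancedRel b.borel M) : b.tensorCoord M u y = 0 := by
  -- The coordinates are only additive while the relations are spanned over `A`, so the induction
  -- treats all multiples `a • y`.
  rw [← one_smul A y]
  refine Submodule.span_induction (p := fun y _ => ∀ a : A, b.tensorCoord M u (a • y) = 0)
    ?_ ?_ ?_ ?_ hy 1
  · rintro _ ⟨a', c, m, rfl⟩ a
    rw [smul_sub, TensorProduct.smul_tmul', TensorProduct.smul_tmul', map_sub, tensorCoord_tmul,
      tensorCoord_tmul, smul_eq_mul, ← mul_assoc, b.dualCoord_mul hC hH, mul_smul, smul_eq_mul,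
      sub_self]
  · intro a
    rw [smul_zero, map_zero]
  · intro y z _ _ hy hz a
    rw [smul_add, map_add, hy, hz, add_zero]
  · intro c y _ hy a
    rw [smul_smul]
    exact hy _

theorem tensorCoord_idTensor (u : P) (f : M →ₗ[b.borel] N) (y : A ⊗[ℤ] M) :
    b.tensorCoord N u (idTensor b.borel f y) = f (b.tensorCoord M u y) := by
  induction y using TensorProduct.induction_on with
  | zero => simp
  | tmul a m => exact (map_smul f _ _).symm
  | add y z hy hz => rw [map_add, map_add, hy, hz, map_add, map_add]

theorem mkQ_eq_sum_tensorCoord [Fintype P] (y : A ⊗[ℤ] M) :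
    (balancedRel b.borel M).mkQ y =
      ∑ u, indTmul b.borel (b.basis u) (b.tensorCoord M u y) := by
  induction y using TensorProduct.induction_on with
  | zero => simp [indTmul_zero]
  | tmul a m =>
    change indTmul b.borel a m = _
    nth_rw 1 [← b.sum_dualCoord a]
    rw [sum_indTmul]
    exact Finset.sum_congr rfl (fun u _ => indTmul_mul _ _ _ _)
  | add y z hy hz => simp only [map_add, hy, hz, indTmul_add, Finset.sum_add_distrib]

end Coordinates

/-- The coordinates identify tensors functorially with families in `M`, so preimages under `f` can
be chosen coordinatewise and reassembled with the dual basis. -/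
theorem indExact_borel [Finite P] (hC : b.NoCycle) (hH : b.NoRelation) : IndExact b.borel := by
  have := Fintype.ofFinite P
  intro M N L _ _ _ _ _ _ _ _ _ f g hfg y
  obtain ⟨y, rfl⟩ := (balancedRel b.borel N).mkQ_surjective y
  constructor
  · intro hy
    have h1 : idTensor b.borel g y ∈ balancedRel b.borel L := by
      rw [← Submodule.Quotient.mk_eq_zero]
      exact hy
    have h2 : ∀ u, ∃ m, f m = b.tensorCoord N u y := by
      intro u
      have h3 := b.tensorCoord_balancedRel hC hH u h1
      rw [tensorCoord_idTensor] at h3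
      exact (hfg _).1 h3
    choose m hm using h2
    refine ⟨∑ u, indTmul b.borel (b.basis u) (m u), ?_⟩
    rw [map_sum, mkQ_eq_sum_tensorCoord]
    exact Finset.sum_congr rfl (fun u _ => by rw [indMap_indTmul, hm])
  · rintro ⟨z, hz⟩
    rw [← hz]
    clear hz
    induction z using ind_induction with
    | h0 => rw [map_zero, map_zero]
    | hadd x z hx hz => rw [map_add, map_add, hx, hz, add_zero]
    | htmul a m => rw [indMap_indTmul, indMap_indTmul, (hfg (f m)).2 ⟨m, rfl⟩, indTmul_zero]

/-- A path that is both a B-path and a D-path from `i` is `e_i`, by `NoCycle`. Conversely, the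
B-part of a path lies in the maximal ideal at `i` unless it is `e_i`, and then the path is its own
D-part. -/
theorem extIdeal_borel (hC : b.NoCycle) (i : Fin n) :
    extIdeal b.borel (b.maxIdeal b.borel i) = b.stdIdeal i := by
  apply le_antisymm
  · rw [extIdeal, Submodule.span_le]
    rintro _ ⟨c, hc, rfl⟩
    rw [SetLike.mem_coe, mem_stdIdeal, mem_sp]
    intro p hp ⟨hD, hs⟩
    have hB : b.IsB p := mem_sp.1 c.2 p hp
    have h0 := hC p hD (le_antisymm hD.tgt_le hB.src_le)
    rw [b.eq_triv p h0, hs, ← char_apply] at hp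
    exact hp hc
  · intro a ha
    refine sp_induction (C := fun a => a ∈ extIdeal b.borel (b.maxIdeal b.borel i)) ?_ ?_ ?_ ?_ ha
    · exact Submodule.zero_mem _
    · exact fun x y hx hy => Submodule.add_mem _ hx hy
    · intro c x hx
      rw [Algebra.smul_def]
      exact Submodule.smul_mem _ _ hx
    · intro p hp
      have hf := b.fac_parts p
      rw [← show _ = b.basis p from hf, ← smul_eq_mul]
      refine Submodule.smul_mem _ _ (Submodule.subset_span
        ⟨⟨b.basis (b.bPart p), b.basis_mem_borel.2 (b.isB_bPart p)⟩, ?_, rfl⟩)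
      rw [mem_maxIdeal]
      by_contra hne
      apply hp
      have h0 : b.len (b.bPart p) = 0 := by
        by_contra hl
        exact hne (char_basis_of_len hl i)
      have h1 : b.bPart p = b.triv i := by
        by_contra h
        apply hne
        rw [char_apply, b.basis.repr_self, Finsupp.single_eq_of_ne (fun h' => h h'.symm)]
      rw [hf.eq_left h0]
      refine ⟨b.isD_dPart p, ?_⟩
      rw [hf.src_eq, h1, b.tgt_triv]

theorem nonempty_ind_borel_equiv (hC : b.NoCycle) (i : Fin n) :
    Nonempty (Ind b.borel (b.borel ⧸ b.maxIdeal b.borel i) ≃ₗ[A] Std e i) := by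
  have h1 := (toIndQuot b.borel (b.maxIdeal b.borel i)).quotKerEquivOfSurjective
    (toIndQuot_surjective _ _)
  have h2 := (toStd e i).quotKerEquivOfSurjective (b.toStd_surjective i)
  exact ⟨h1.symm.trans ((Submodule.quotEquivOfEq _ _ (by
    rw [ker_toIndQuot, b.extIdeal_borel hC, b.ker_toStd])).trans h2)⟩

theorem e_mul_mul_e_of_mem_borel {c : A} (hc : c ∈ b.borel) {i j : Fin n} (h : j < i) :
    e j * (c * e i) = 0 := by
  refine sp_induction (C := fun c => e j * (c * e i) = 0) ?_ ?_ ?_ ?_ hc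
  · simp
  · intro x y hx hy
    rw [add_mul, mul_add, hx, hy, add_zero]
  · intro t x hx
    rw [smul_mul_assoc, mul_smul_comm, hx, smul_zero]
  · intro p hp
    rw [b.basis_mul_e]
    split_ifs with h1
    · rw [b.e_mul_basis, if_neg]
      rintro rfl
      exact absurd (IsB.src_le hp) (not_le.2 (h1 ▸ h))
    · rw [mul_zero]

theorem subsingleton_ext_borel {i j : Fin n} (h : j < i) :
    Subsingleton (CategoryTheory.Abelian.Ext.{w}
      (ModuleCat.of b.borel (b.borel ⧸ b.maxIdeal b.borel i))
      (ModuleCat.of b.borel (b.borel ⧸ b.maxIdeal b.borel j)) 1) := by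
  refine subsingleton_ext_one _ _ (fun f => ?_)
  -- For `j < i` and `c` in the ideal, `e_j c e_i = 0`, so `f c = e_j f c = f (c (1 - e_i)) = c f (1
  -- - e_i)`. Thus `1 ↦ f (1 - e_i)` extends `f`.
  let t : b.maxIdeal b.borel i := ⟨_, b.one_sub_e_mem b.e_mem_borel i⟩
  refine ⟨LinearMap.toSpanSingleton _ _ (f t), fun c => ?_⟩
  rw [LinearMap.toSpanSingleton_apply, ← map_smul, ← sub_eq_zero, ← map_sub]
  have h1 : ∀ y, (⟨e j, b.e_mem_borel j⟩ : b.borel) • f y = f y := by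
    intro y
    obtain ⟨d, hd⟩ := (b.maxIdeal b.borel j).mkQ_surjective (f y)
    rw [← hd, ← map_smul, ← sub_eq_zero, ← map_sub, Submodule.mkQ_apply,
      Submodule.Quotient.mk_eq_zero, mem_maxIdeal]
    change b.char j (e j * d - d) = 0
    rw [map_sub, map_mul, char_e, if_pos rfl, one_mul, sub_self]
  rw [← h1, ← map_smul]
  convert map_zero f
  apply Subtype.ext
  apply Subtype.ext
  change e j * ((c : A) * (1 - e i) - c) = 0
  rw [mul_sub ((c : b.borel) : A) 1 (e i), mul_one, sub_sub_cancel_left, mul_neg,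
    b.e_mul_mul_e_of_mem_borel (c : b.borel).2 h, neg_zero]

open scoped ModuleCat in
theorem nonempty_end_quotient {B : Subalgebra k A} {i : Fin n} (M : ModuleCat.{w} B)
    (φ : M ≃ₗ[B] (B ⧸ b.maxIdeal B i)) : Nonempty (Module.End B M ≃ₐ[k] k) := by
  refine nonempty_end_algEquiv (S := B) (φ.symm ((b.maxIdeal B i).mkQ 1)) ?_ ?_
  · rw [Ne, LinearEquiv.map_eq_zero_iff, Submodule.mkQ_apply, Submodule.Quotient.mk_eq_zero,
      mem_maxIdeal]
    change b.char i 1 ≠ 0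
    rw [map_one]
    exact one_ne_zero
  · intro m
    obtain ⟨c, hc⟩ := (b.maxIdeal B i).mkQ_surjective (φ m)
    refine ⟨b.char i (c : A), ?_⟩
    rw [← algebraMap_smul B (b.char i (c : A)), ← map_smul, LinearEquiv.eq_symm_apply, ← hc,
      ← map_smul, ← sub_eq_zero, ← map_sub, Submodule.mkQ_apply,
      Submodule.Quotient.mk_eq_zero, mem_maxIdeal]
    change b.char i ((c : A) - algebraMap k A (b.char i (c : A)) * 1) = 0
    rw [mul_one, map_sub, AlgHom.commutes]
    exact sub_self _

open scoped ModuleCat in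
theorem nonempty_end_equiv_end_simp [Finite P] {B : Subalgebra k A} {i : Fin n}
    (M : ModuleCat.{w} B) (φ : M ≃ₗ[B] (B ⧸ b.maxIdeal B i)) :
    Nonempty (Module.End B M ≃ₐ[k] Module.End A (Simp e i)) := by
  obtain ⟨ψ⟩ := b.nonempty_end_quotient M φ
  obtain ⟨ψ'⟩ := b.nonempty_end_simp i
  exact ⟨ψ.trans ψ'.symm⟩

theorem isExactBorel_borel [Finite P] (hC : b.NoCycle) (hH : b.NoRelation) :
    IsExactBorel b.borel e := by
  refine ⟨b.indExact_borel hC hH,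
    fun i => ModuleCat.of b.borel (b.borel ⧸ b.maxIdeal b.borel i), fun i => ?_, ?_, ?_, ?_, ?_, ?_⟩
  · exact b.isSimpleModule_quotient b.borel i
  · rintro i j ⟨φ⟩
    exact b.eq_of_equiv b.e_mem_borel φ
  · intro M hM
    exact b.exists_equiv_of_isSimpleModule b.e_mem_borel M
  · exact b.nonempty_ind_borel_equiv hC
  · exact fun i => b.nonempty_end_equiv_end_simp
      (ModuleCat.of b.borel (b.borel ⧸ b.maxIdeal b.borel i)) (LinearEquiv.refl _ _)
  · intro i j hij
    by_contra h
    have := b.subsingleton_ext_borel (not_le.1 h)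
    exact not_nontrivial _ hij

end MonomialBasis

namespace MonomialBasis

variable {k : Type u} [Field k] {A : Type w} [Ring A] [Algebra k A] {n : ℕ}
  {e : Fin n → A} {P : Type x} (b : MonomialBasis k e P)

/-! ### Right-minimal direction-preserving paths -/

/-- The set of all paths. -/
abbrev paths : Set A := Set.range b.basis

theorem isDirectionPreserving_basis {p : P} :
    IsDirectionPreserving e (b.basis p) ↔ b.src p < b.tgt p := by
  constructor
  · rintro ⟨i, j, hij, h⟩
    have hj : j = b.tgt p := by
      by_contra hj
      rw [e_mul_basis, if_neg hj, zero_mul] at h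
      exact basis_ne p h
    have hi : i = b.src p := by
      by_contra hi
      rw [mul_assoc, basis_mul_e, if_neg hi, mul_zero] at h
      exact basis_ne p h
    rwa [← hi, ← hj]
  · intro h
    exact ⟨_, _, h, by rw [b.e_mul, b.mul_e]⟩

/-- The trivial paths and those with a direction-preserving initial segment. -/
def HasDP (p : P) : Prop := b.len p = 0 ∨ ∃ q r, b.Fac p q r ∧ b.src r < b.tgt r

variable {b} in
theorem HasDP.mul {p q r : P} (h : b.Fac p q r) (hq : b.HasDP q) (hr : b.HasDP r) :
    b.HasDP p := by
  rcases hr with hr | ⟨s, t, hst, hlt⟩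
  · rwa [h.eq_left hr]
  · obtain ⟨z, hz, -⟩ := h.assoc_left hst
    exact Or.inr ⟨z, t, hz, hlt⟩

theorem Bmax_le {a : A} (ha : a ∈ Bmax k e b.paths) : a ∈ b.sp {p | b.HasDP p} := by
  have h1 : (1 : A) ∈ b.sp {p | b.HasDP p} := by
    rw [← b.sum_e]
    refine Submodule.sum_mem _ (fun i _ => ?_)
    rw [← b.basis_triv]
    exact basis_mem_sp.2 (Or.inl (b.len_triv i))
  have h2 : Bmax k e b.paths ≤ (b.sp {p | b.HasDP p}).toSubalgebra h1
      (fun _ _ hx hy => mul_mem_sp (fun _ hp _ hq _ hr => HasDP.mul hr hp hq) hx hy) := by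
    rw [Bmax, Algebra.adjoin_le_iff]
    rintro _ (⟨i, rfl⟩ | ⟨⟨p, rfl⟩, hp⟩)
    · rw [← b.basis_triv]
      exact basis_mem_sp.2 (Or.inl (b.len_triv i))
    · exact basis_mem_sp.2 (Or.inr ⟨_, _, fac_tgt p, b.isDirectionPreserving_basis.1 hp⟩)
  exact h2 ha

theorem e_mem_Bmax (i : Fin n) : e i ∈ Bmax k e b.paths :=
  Algebra.subset_adjoin (Or.inl ⟨i, rfl⟩)

theorem basis_mem_Bmax {p : P} (hp : b.src p < b.tgt p) : b.basis p ∈ Bmax k e b.paths :=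
  Algebra.subset_adjoin (Or.inr ⟨⟨p, rfl⟩, b.isDirectionPreserving_basis.2 hp⟩)

theorem len_ne_zero_of_lt {p : P} (hp : b.src p < b.tgt p) : b.len p ≠ 0 := by
  intro h
  have h1 : b.tgt p = b.src p := by
    rw [b.eq_triv p h, b.tgt_triv, b.src_triv]
  exact hp.ne' h1

/-- A nontrivial path in `B_max` has a direction-preserving initial segment, and a further left
factor from `rad(A)` makes that segment proper. So inside `B_max`, minimality means having no proper
direction-preserving initial segment. -/
theorem isRightMinimal_basis_iff [Finite P] {p : P} : IsRightMinimal k e b.paths (b.basis p) ↔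
    b.basis p ∈ Bmax k e b.paths ∧ ∀ q r, b.Fac p q r → b.src r < b.tgt r → b.len q = 0 := by
  refine and_congr_right (fun _ => ⟨fun h q r hf hr => ?_, fun h hmem => ?_⟩)
  · by_contra hq
    refine h (Submodule.subset_span ⟨b.basis q, ?_, ⟨b.basis r, b.basis_mem_Bmax hr⟩, ?_, hf.symm⟩)
    · exact (b.mem_jacobson _).2 (char_basis_of_len hq)
    · exact (b.mem_jacobson_subalgebra _ _).2 (char_basis_of_len (b.len_ne_zero_of_lt hr))
  · have hle : radRad k e b.paths ≤
        b.sp {p | ∃ q r, b.Fac p q r ∧ b.src r < b.tgt r ∧ b.len q ≠ 0} := by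
      rw [radRad, Submodule.span_le]
      rintro _ ⟨a, ha, c, hc, rfl⟩
      have ha' : a ∈ b.sp {p | b.len p ≠ 0} := mem_sp_len_pos.2 ((b.mem_jacobson _).1 ha)
      have hc' : (c : A) ∈ b.sp {p | b.HasDP p ∧ b.len p ≠ 0} := by
        refine mem_sp.2 (fun p hp => ⟨mem_sp.1 (b.Bmax_le c.2) p hp, ?_⟩)
        exact mem_sp.1 (mem_sp_len_pos.2 ((b.mem_jacobson_subalgebra _ _).1 hc)) p hp
      refine mul_mem_sp ?_ ha' hc'
      rintro q hq r ⟨hr, hr'⟩ p hp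
      obtain ⟨s, t, hst, hlt⟩ := hr.resolve_left hr'
      obtain ⟨z, hz, hz'⟩ := hp.assoc_left hst
      refine ⟨z, t, hz, hlt, ?_⟩
      have := hz'.len
      simp only [Set.mem_ofPred_eq] at hq
      omega
    obtain ⟨q, r, hf, hr, hq⟩ := basis_mem_sp.1 (hle hmem)
    exact hq (h q r hf hr)

theorem isRightMinimal_e [Finite P] (i : Fin n) : IsRightMinimal k e b.paths (e i) := by
  rw [← b.basis_triv, isRightMinimal_basis_iff, b.basis_triv]
  refine ⟨b.e_mem_Bmax i, fun q r h _ => ?_⟩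
  have := h.len
  rw [b.len_triv] at this
  omega

theorem len_eq_zero_or_lt_of_isRightMinimal [Finite P] {p : P}
    (h : IsRightMinimal k e b.paths (b.basis p)) : b.len p = 0 ∨ b.src p < b.tgt p := by
  rw [isRightMinimal_basis_iff] at h
  rcases basis_mem_sp.1 (b.Bmax_le h.1) with h0 | ⟨q, r, hf, hr⟩
  · exact Or.inl h0
  · rw [hf.eq_right (h.2 q r hf hr)]
    exact Or.inr hr

/-- An initial segment that is direction-preserving is the whole path. Any other ends at most at the
source, which is at most the target. -/
theorem isB_of_isRightMinimal [Finite P] {p : P} (h : IsRightMinimal k e b.paths (b.basis p)) :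
    b.IsB p := by
  rcases b.len_eq_zero_or_lt_of_isRightMinimal h with h0 | hlt
  · rw [b.eq_triv p h0]
    exact isB_triv _
  · rw [isRightMinimal_basis_iff] at h
    intro q r hf
    rcases lt_or_ge (b.src r) (b.tgt r) with hr | hr
    · rw [hf.eq_right (h.2 q r hf hr)]
    · exact hr.trans (hf.src ▸ hlt.le)

theorem Bmin_eq_borel [Finite P] (hC : b.NoCycle) : Bmin k e b.paths = b.borel := by
  apply le_antisymm
  · rw [Bmin, Algebra.adjoin_le_iff]
    rintro _ ⟨⟨p, rfl⟩, hp⟩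
    exact b.basis_mem_borel.2 (b.isB_of_isRightMinimal hp)
  · have key : ∀ l p, b.len p = l → b.IsB p → b.basis p ∈ Bmin k e b.paths := by
      intro l
      induction l using Nat.strong_induction_on with
      | _ l ih =>
      rintro p rfl hp
      by_cases h0 : b.len p = 0
      · rw [b.eq_triv p h0, b.basis_triv]
        exact Algebra.subset_adjoin ⟨⟨_, b.basis_triv _⟩, b.isRightMinimal_e _⟩
      have hlt : b.src p < b.tgt p := by
        refine lt_of_le_of_ne hp.src_le (fun heq => h0 (hC p (fun q r h => ?_) heq.symm))
        exact (hp q r h).trans_eq heq.symm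
      classical
      -- The shortest direction-preserving initial segment is right-minimal. What remains is a
      -- shorter B-path, to which the induction applies.
      have hex : ∃ m, ∃ c y, b.Fac p c y ∧ b.src y < b.tgt y ∧ b.len y = m :=
        ⟨_, _, _, fac_tgt p, hlt, rfl⟩
      obtain ⟨c, y, hf, hy, hm⟩ := Nat.find_spec hex
      have hmin : IsRightMinimal k e b.paths (b.basis y) := by
        rw [isRightMinimal_basis_iff]
        refine ⟨b.basis_mem_Bmax hy, fun q r hqr hr => ?_⟩
        obtain ⟨z, hz, -⟩ := hf.assoc_left hqr
        have h1 := Nat.find_min' hex ⟨z, r, hz, hr, rfl⟩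
        have h2 := hqr.len
        omega
      rw [← show _ = b.basis p from hf]
      refine Subalgebra.mul_mem _ (ih (b.len c) ?_ c rfl (hp.left hf))
        (Algebra.subset_adjoin ⟨⟨y, rfl⟩, hmin⟩)
      have h1 := hf.len
      have h2 := b.len_ne_zero_of_lt hy
      omega
    intro a ha
    refine sp_induction (C := fun a => a ∈ Bmin k e b.paths) ?_ ?_ ?_ ?_ ha
    · exact Subalgebra.zero_mem _
    · exact fun x y hx hy => Subalgebra.add_mem _ hx hy
    · exact fun c x hx => Subalgebra.smul_mem _ hx c
    · exact fun p hp => key _ p rfl hp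

theorem hasPathBasis_iff {B : Subalgebra k A} :
    HasPathBasis b.paths B ↔ ∃ T : Set P, ∀ a, a ∈ B ↔ a ∈ b.sp T := by
  constructor
  · rintro ⟨S, hS, -, hspan⟩
    refine ⟨b.basis ⁻¹' S, fun a => ?_⟩
    rw [sp, Set.image_preimage_eq_of_subset hS, hspan, Subalgebra.mem_toSubmodule]
  · rintro ⟨T, hT⟩
    refine ⟨b.basis '' T, Set.image_subset_range _ _, ?_, ?_⟩
    · exact (b.basis.linearIndependent.linearIndepOn_id).mono (Set.image_subset_range _ _)
    · ext a
      exact (hT a).symm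

theorem hasPathBasis_borel : HasPathBasis b.paths b.borel :=
  b.hasPathBasis_iff.2 ⟨_, fun _ => Iff.rfl⟩

/-- A nontrivial right-minimal path `p` lies in the left ideal that generates the kernel of `A →
Δ_{src p}`, so it ends (on the right) in some path `s` of `B`. This `s` is also in the kernel, so it
visits a vertex above its source. By minimality the initial segment up to there is all of `p`, hence
`s = p`. -/
theorem containsRightMinimal_of_hasPathBasis [Finite P] {B : Subalgebra k A}
    (hB : IsExactBorel B e) (h : HasPathBasis b.paths B) : ContainsRightMinimal e b.paths B := by
  obtain ⟨T, hT⟩ := b.hasPathBasis_iff.1 h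
  -- The unit has coefficient one at every trivial path.
  have htriv : ∀ i, b.triv i ∈ T := by
    intro i
    refine mem_sp.1 ((hT 1).1 B.one_mem) _ ?_
    rw [← char_apply, map_one]
    exact one_ne_zero
  have he : ∀ i, e i ∈ B := fun i => by
    rw [hT, ← b.basis_triv]
    exact basis_mem_sp.2 (htriv i)
  refine ⟨he, ?_⟩
  rintro _ ⟨p, rfl⟩ hp
  rcases b.len_eq_zero_or_lt_of_isRightMinimal hp with h0 | hlt
  · rw [b.eq_triv p h0, b.basis_triv]
    exact he _
  rw [isRightMinimal_basis_iff] at hp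
  obtain ⟨φ⟩ := b.nonempty_ind_equiv he hB (b.src p)
  have hext := b.extIdeal_eq he φ
  have h1 : b.basis p ∈ extIdeal B (b.maxIdeal B (b.src p)) := by
    rw [hext, basis_mem_stdIdeal]
    rintro ⟨hD, -⟩
    exact absurd hD.tgt_le (not_le.2 hlt)
  have h2 : b.basis p ∈ b.sp {w | ∃ q s, b.Fac w q s ∧ s ∈ T ∧ s ≠ b.triv (b.src p)} := by
    refine Submodule.span_induction (p := fun y _ =>
      y ∈ b.sp {w | ∃ q s, b.Fac w q s ∧ s ∈ T ∧ s ≠ b.triv (b.src p)}) ?_ ?_ ?_ ?_ h1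
    · rintro _ ⟨c, hc, rfl⟩
      refine mem_sp.2 (fun s hs => ⟨_, s, fac_tgt s, mem_sp.1 ((hT c).1 c.2) s hs, ?_⟩)
      rintro rfl
      exact hs hc
    · exact Submodule.zero_mem _
    · exact fun x y _ _ hx hy => Submodule.add_mem _ hx hy
    · intro a y _ hy
      refine mul_mem_sp ?_ (mem_sp_univ a) hy
      rintro q' - w ⟨q, s, hf, hs⟩ w' hw'
      obtain ⟨z, hz, -⟩ := hw'.assoc_left hf
      exact ⟨z, s, hz, hs⟩
  obtain ⟨q, s, hf, hs, hs'⟩ := basis_mem_sp.1 h2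
  have hsB : b.basis s ∈ B := (hT _).2 (basis_mem_sp.2 hs)
  have h3 : b.basis s ∈ b.stdIdeal (b.src p) := by
    rw [← hext]
    refine Submodule.subset_span ⟨⟨b.basis s, hsB⟩, ?_, rfl⟩
    rw [mem_maxIdeal, char_apply, b.basis.repr_self, Finsupp.single_eq_of_ne (fun h => hs' h.symm)]
  rw [basis_mem_stdIdeal] at h3
  have h4 : ¬ b.IsD s := fun h => h3 ⟨h, hf.src.symm⟩
  simp only [IsD, not_forall, not_le] at h4
  obtain ⟨q', r, hr, hlt'⟩ := h4
  obtain ⟨z, hz, hz'⟩ := hf.assoc_left hr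
  have h5 := hp.2 z r hz (hr.src ▸ hlt')
  have h6 := hz'.len
  rw [hf.eq_right (by omega)]
  exact hsB

/-- Both subalgebras generate the same kernels `stdIdeal i`, so the comparison `eq_of_le` applies.
-/
theorem eq_Bmin_of_containsRightMinimal [Finite P] (hC : b.NoCycle)
    {B : Subalgebra k A} (hB : IsExactBorel B e) (h : ContainsRightMinimal e b.paths B) :
    B = Bmin k e b.paths := by
  have hle : Bmin k e b.paths ≤ B := by
    rw [Bmin, Algebra.adjoin_le_iff]
    exact fun y hy => h.2 y hy.1 hy.2
  rw [b.Bmin_eq_borel hC] at hle ⊢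
  refine b.eq_of_le b.e_mem_borel hle hB.1 (b.nonempty_ind_equiv h.1 hB) (fun i => ?_)
  obtain ⟨φ⟩ := b.nonempty_ind_equiv h.1 hB i
  rw [b.extIdeal_eq h.1 φ, b.extIdeal_borel hC]

theorem hasPathBasis_iff_containsRightMinimal [Finite P] (hC : b.NoCycle) {B : Subalgebra k A}
    (hB : IsExactBorel B e) : HasPathBasis b.paths B ↔ ContainsRightMinimal e b.paths B := by
  refine ⟨b.containsRightMinimal_of_hasPathBasis hB, fun h => ?_⟩
  rw [b.eq_Bmin_of_containsRightMinimal hC hB h, b.Bmin_eq_borel hC]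
  exact b.hasPathBasis_borel

theorem isExactBorel_and_hasPathBasis_iff [Finite P] (hC : b.NoCycle) (hH : b.NoRelation)
    (B : Subalgebra k A) :
    (IsExactBorel B e ∧ HasPathBasis b.paths B) ↔ B = Bmin k e b.paths := by
  constructor
  · rintro ⟨h, h'⟩
    exact b.eq_Bmin_of_containsRightMinimal hC h (b.containsRightMinimal_of_hasPathBasis h h')
  · rintro rfl
    rw [b.Bmin_eq_borel hC]
    exact ⟨b.isExactBorel_borel hC hH, b.hasPathBasis_borel⟩

/-! ### The opposite algebra -/

/-- The reversed paths form a basis of the opposite algebra. -/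
noncomputable def op : MonomialBasis k (fun i => MulOpposite.op (e i)) P where
  basis := b.basis.map (MulOpposite.opLinearEquiv k)
  src := b.tgt
  tgt := b.src
  len := b.len
  triv := b.triv
  basis_triv i := congrArg MulOpposite.op (b.basis_triv i)
  sum_e := by
    rw [← Finset.op_sum, b.sum_e]
    rfl
  src_triv := b.tgt_triv
  tgt_triv := b.src_triv
  len_triv := b.len_triv
  eq_triv _ := eq_triv_tgt
  e_mul p := congrArg MulOpposite.op (b.mul_e p)
  mul_e p := congrArg MulOpposite.op (b.e_mul p)
  mul_of_ne p q h := congrArg MulOpposite.op (b.mul_of_ne q p h.symm)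
  mul_eq p q := by
    rcases b.mul_eq q p with h | ⟨r, h⟩
    · exact Or.inl (congrArg MulOpposite.op h)
    · exact Or.inr ⟨r, congrArg MulOpposite.op h⟩
  src_mul h := b.tgt_mul (MulOpposite.op_injective h)
  tgt_mul h := b.src_mul (MulOpposite.op_injective h)
  len_mul h := (b.len_mul (MulOpposite.op_injective h)).trans (add_comm _ _)
  split r l h := by
    -- An initial segment of length `l` of the reversed path is a final segment of `r`.
    obtain ⟨p, q, hf, hq⟩ := b.split r (b.len r - l) (Nat.sub_le _ _)
    refine ⟨q, p, congrArg MulOpposite.op hf, ?_⟩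
    have := b.len_mul hf
    omega
  cancel {p q p' q' r} h h' hl := by
    have h1 : b.Fac r q p := MulOpposite.op_injective h
    have h2 : b.Fac r q' p' := MulOpposite.op_injective h'
    have h3 := h1.len
    have h4 := h2.len
    exact (b.cancel h1 h2 (by omega)).symm

theorem fac_op {p q r : P} : b.op.Fac p q r ↔ b.Fac p r q := MulOpposite.op_injective.eq_iff

theorem isD_op {p : P} : b.op.IsD p ↔ b.IsB p :=
  ⟨fun h q r hf => hf.src_eq ▸ h r q (b.fac_op.2 hf), fun h q r hf =>
    ((b.fac_op.1 hf).src_eq.trans_le (h r q (b.fac_op.1 hf)))⟩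

theorem isB_op {p : P} : b.op.IsB p ↔ b.IsD p :=
  ⟨fun h q r hf => hf.src_eq ▸ h r q (b.fac_op.2 hf), fun h q r hf =>
    ((b.fac_op.1 hf).src_eq.trans_le (h r q (b.fac_op.1 hf)))⟩

variable {b} in
theorem NoCycle.op (hC : b.NoCycle) : b.op.NoCycle := by
  intro p hp hc
  have hc' : b.src p = b.tgt p := hc
  exact hC p (fun q r h => (b.isD_op.1 hp q r h).trans_eq hc'.symm) hc'.symm

variable {b} in
theorem NoRelation.op (hH : b.NoRelation) : b.op.NoRelation := by
  intro u c hu hc huc h0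
  exact hH c u (b.isB_op.1 hc) (b.isD_op.1 hu) huc.symm (MulOpposite.op_injective h0)

theorem paths_op : b.op.paths = MulOpposite.op '' b.paths := by
  rw [paths, ← Set.range_comp]
  rfl

theorem op_mem_sp {T : Set P} {a : A} : MulOpposite.op a ∈ b.op.sp T ↔ a ∈ b.sp T := by
  rw [mem_sp, mem_sp]
  rfl

theorem hasPathBasis_op {C : Subalgebra k A} :
    HasPathBasis b.op.paths C.op ↔ HasPathBasis b.paths C := by
  rw [hasPathBasis_iff, hasPathBasis_iff]
  refine exists_congr (fun T => ⟨fun h a => ?_, fun h a => ?_⟩)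
  · rw [← op_mem_sp, ← h]
    rfl
  · obtain ⟨a, rfl⟩ := MulOpposite.op_surjective a
    rw [op_mem_sp, ← h]
    rfl

theorem isDeltaSubalgebra_and_hasPathBasis_iff [Finite P] (hC : b.NoCycle) (hH : b.NoRelation)
    (C : Subalgebra k A) :
    (IsDeltaSubalgebra e C ∧ HasPathBasis b.paths C) ↔ C = CminOp k e b.paths := by
  rw [IsDeltaSubalgebra, ← hasPathBasis_op, b.op.isExactBorel_and_hasPathBasis_iff hC.op hH.op,
    CminOp, ← paths_op]
  exact ⟨fun h => by rw [← h, Subalgebra.unop_op], fun h => by rw [h, Subalgebra.op_unop]⟩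

end MonomialBasis

/-! ### Unique factorisation and finiteness of quiver paths -/

section Paths

variable {n : ℕ} {Q : Quiver.{v} (Fin n)}

theorem QPath.length_comp (p q : QPath Q) (h : q.tgt = p.src) :
    (p.comp q h).length = p.length + q.length := by
  obtain ⟨a, b, p⟩ := p
  obtain ⟨c, d, q⟩ := q
  dsimp only at h
  subst h
  simp [QPath.comp, QPath.length, add_comm]

theorem QPath.eq_trivial {p : QPath Q} (h : p.length = 0) : p = QPath.trivial Q p.src := by
  obtain ⟨a, b, p⟩ := p
  cases p with
  | nil => rfl
  | cons p f => exact absurd h (Nat.succ_ne_zero _)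

theorem QPath.exists_comp (p : QPath Q) {l : ℕ} (hl : l ≤ p.length) :
    ∃ q r h, p = QPath.comp q r h ∧ r.length = l := by
  obtain ⟨a, b, p⟩ := p
  obtain ⟨c, p₁, p₂, hp, hp₁⟩ := p.exists_eq_comp_of_le_length hl
  subst hp
  exact ⟨⟨c, b, p₂⟩, ⟨a, c, p₁⟩, rfl, rfl, hp₁⟩

/-- Peel off the last arrows of the final segments simultaneously. -/
theorem path_comp_inj {a b c c' : Fin n} {p : Quiver.Path a c} {q : Quiver.Path c b}
    {p' : Quiver.Path a c'} {q' : Quiver.Path c' b} (hl : q.length = q'.length)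
    (h : p.comp q = p'.comp q') : c = c' ∧ p ≍ p' ∧ q ≍ q' := by
  induction q with
  | nil =>
    have hc := q'.eq_of_length_zero hl.symm
    subst hc
    have hq := q'.eq_nil_of_length_zero hl.symm
    subst hq
    exact ⟨rfl, heq_of_eq h, HEq.rfl⟩
  | cons q f ih =>
    cases q' with
    | nil => exact absurd hl (Nat.succ_ne_zero _)
    | cons q' f' =>
      rw [Quiver.Path.comp_cons, Quiver.Path.comp_cons] at h
      injection h with h1 _ h2 h3
      subst h1
      obtain ⟨rfl, hp, hq⟩ := ih (Nat.succ_injective hl) (eq_of_heq h2)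
      exact ⟨rfl, hp, by rw [eq_of_heq hq, eq_of_heq h3]⟩

theorem QPath.comp_inj {p q p' q' : QPath Q} {h : q.tgt = p.src} {h' : q'.tgt = p'.src}
    (hl : q.length = q'.length) (hc : p.comp q h = p'.comp q' h') : p = p' ∧ q = q' := by
  obtain ⟨a, b, p⟩ := p
  obtain ⟨c, d, q⟩ := q
  obtain ⟨a', b', p'⟩ := p'
  obtain ⟨c', d', q'⟩ := q'
  dsimp only at h h'
  subst h h'
  have hl' : p.length = p'.length := by
    have h1 := QPath.length_comp ⟨d, b, p⟩ ⟨c, d, q⟩ rfl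
    have h2 := QPath.length_comp ⟨d', b', p'⟩ ⟨c', d', q'⟩ rfl
    rw [hc, h2, hl] at h1
    exact (Nat.add_right_cancel h1).symm
  simp only [QPath.comp, Quiver.Path.cast_rfl_rfl, QPath.mk.injEq] at hc
  obtain ⟨rfl, rfl, hc⟩ := hc
  obtain ⟨rfl, hq, hp⟩ := path_comp_inj hl' (eq_of_heq hc)
  rw [eq_of_heq hq, eq_of_heq hp]
  exact ⟨rfl, rfl⟩

theorem QPath.finite_length_eq (hQ : ∀ i j, Finite (Q.Hom i j)) (l : ℕ) :
    {p : QPath Q | p.length = l}.Finite := by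
  induction l with
  | zero =>
    refine (Set.finite_range (QPath.trivial Q)).subset (fun p hp => ?_)
    exact ⟨_, (QPath.eq_trivial hp).symm⟩
  | succ l ih =>
    have := ih.to_subtype
    have : Finite (Σ p : {p : QPath Q | p.length = l}, Σ j, Q.Hom p.1.tgt j) := inferInstance
    refine (Set.finite_range (fun y : Σ p : {p : QPath Q | p.length = l}, Σ j, Q.Hom p.1.tgt j =>
      (⟨y.1.1.src, y.2.1, y.1.1.path.cons y.2.2⟩ : QPath Q))).subset ?_
    rintro ⟨a, b, p⟩ hp
    cases p with
    | nil => exact absurd hp.symm (Nat.succ_ne_zero _)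
    | cons p f => exact ⟨⟨⟨⟨_, _, p⟩, Nat.succ_injective hp⟩, ⟨_, f⟩⟩, rfl⟩

theorem QPath.finite_length_lt (hQ : ∀ i j, Finite (Q.Hom i j)) (N : ℕ) :
    {p : QPath Q | p.length < N}.Finite := by
  refine ((Set.finite_lt_nat N).biUnion (fun l _ => QPath.finite_length_eq hQ l)).subset ?_
  intro p hp
  exact Set.mem_biUnion (x := p.length) hp rfl

end Paths

/-! ### Nonzero paths as a basis of the monomial algebra -/

section Monomial

variable {n : ℕ} {Q : Quiver.{v} (Fin n)} (k : Type u) [Field k] (R : Set (QPath Q))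

/-- The basis of the path algebra consisting of all paths. -/
noncomputable def pathBasis (Q : Quiver.{v} (Fin n)) :
    Module.Basis (QPath Q) k (PathAlgebra k Q) :=
  (Finsupp.basisSingleOne : Module.Basis (QPath Q) k (QPath Q →₀ k))

theorem pathBasis_apply (p : QPath Q) : pathBasis k Q p = PathAlgebra.of k p := by
  exact congrFun (Finsupp.coe_basisSingleOne (R := k) (ι := QPath Q)) p

theorem of_comp (p q : QPath Q) (h : q.tgt = p.src) :
    PathAlgebra.of k (p.comp q h) = PathAlgebra.of k p * PathAlgebra.of k q := by
  rw [PathAlgebra.of_mul_of, PathAlgebra.mulPath, dif_pos h]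

theorem of_mul_of_eq_zero {p q : QPath Q} (h : ¬ q.tgt = p.src) :
    PathAlgebra.of k p * PathAlgebra.of k q = 0 := by
  rw [PathAlgebra.of_mul_of, PathAlgebra.mulPath, dif_neg h]

variable {k R} in
-- A set of paths closed under concatenation on either side spans a two-sided ideal. Used for paths
-- of length at least two and for the paths contained in `I`.
theorem mem_span_of_mem_monomialIdeal {D : Set (QPath Q)}
    (hl : ∀ p q h, q ∈ D → QPath.comp p q h ∈ D) (hr : ∀ p q h, p ∈ D → QPath.comp p q h ∈ D)
    (hR : R ⊆ D) {y : PathAlgebra k Q} (hy : y ∈ monomialIdeal k R) :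
    y ∈ Submodule.span k (PathAlgebra.of k '' D) := by
  have htop : ∀ z : PathAlgebra k Q, z ∈ Submodule.span k (Set.range (PathAlgebra.of k)) := by
    intro z
    have h := (pathBasis k Q).mem_span z
    rwa [show ⇑(pathBasis k Q) = PathAlgebra.of k from funext (pathBasis_apply k)] at h
  let J : TwoSidedIdeal (PathAlgebra k Q) :=
    TwoSidedIdeal.mk' (Submodule.span k (PathAlgebra.of k '' D)) (Submodule.zero_mem _)
      (Submodule.add_mem _) (Submodule.neg_mem _) (by
        intro z y hy
        have h : Submodule.span k (Set.range (PathAlgebra.of k)) *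
            Submodule.span k (PathAlgebra.of k '' D) ≤
            Submodule.span k (PathAlgebra.of k (Q := Q) '' D) := by
          rw [Submodule.span_mul_span, Submodule.span_le]
          rintro _ ⟨_, ⟨p, rfl⟩, _, ⟨q, hq, rfl⟩, rfl⟩
          by_cases h : q.tgt = p.src
          · exact Submodule.subset_span ⟨_, hl p q h hq, of_comp k p q h⟩
          · simp only [of_mul_of_eq_zero k h, SetLike.mem_coe, Submodule.zero_mem]
        exact h (Submodule.mul_mem_mul (htop z) hy)) (by
        intro y z hy
        have h : Submodule.span k (PathAlgebra.of k '' D) *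
            Submodule.span k (Set.range (PathAlgebra.of k)) ≤
            Submodule.span k (PathAlgebra.of k (Q := Q) '' D) := by
          rw [Submodule.span_mul_span, Submodule.span_le]
          rintro _ ⟨_, ⟨p, hp, rfl⟩, _, ⟨q, rfl⟩, rfl⟩
          by_cases h : q.tgt = p.src
          · exact Submodule.subset_span ⟨_, hr p q h hp, of_comp k p q h⟩
          · simp only [of_mul_of_eq_zero k h, SetLike.mem_coe, Submodule.zero_mem]
        exact h (Submodule.mul_mem_mul hy (htop z)))
  have hle : monomialIdeal k R ≤ J := by
    rw [monomialIdeal, TwoSidedIdeal.span_le]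
    rintro _ ⟨p, hp, rfl⟩
    exact (TwoSidedIdeal.mem_mk' _ _ _ _ _ _ _).2 (Submodule.subset_span ⟨p, hR hp, rfl⟩)
  exact (TwoSidedIdeal.mem_mk' _ _ _ _ _ _ _).1 (hle hy)

variable {k} in
theorem of_mem_span_iff {D : Set (QPath Q)} {p : QPath Q} :
    PathAlgebra.of k p ∈ Submodule.span k (PathAlgebra.of k '' D) ↔ p ∈ D := by
  rw [← show ⇑(pathBasis k Q) = PathAlgebra.of k from funext (pathBasis_apply k)]
  rw [(pathBasis k Q).mem_span_image, (pathBasis k Q).repr_self,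
    Finsupp.support_single _ one_ne_zero]
  simp

variable {k R} in
theorem IsAdmissible.length_of_mem (hR : IsAdmissible k R) {p : QPath Q}
    (hp : PathAlgebra.of k p ∈ monomialIdeal k R) : 2 ≤ p.length := by
  have h := mem_span_of_mem_monomialIdeal (D := {p | 2 ≤ p.length}) ?_ ?_ hR.1 hp
  · exact of_mem_span_iff.1 h
  · intro p q h hq
    rw [Set.mem_ofPred_eq] at hq ⊢
    rw [QPath.length_comp]
    omega
  · intro p q h hq
    rw [Set.mem_ofPred_eq] at hq ⊢
    rw [QPath.length_comp]
    omega

/-- The paths of `Q` whose residue classes are nonzero. -/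
abbrev NonzeroPath : Type v := {p : QPath Q // PathAlgebra.of k p ∉ monomialIdeal k R}

theorem pathClass_eq_zero {p : QPath Q} :
    pathClass k R p = 0 ↔ PathAlgebra.of k p ∈ monomialIdeal k R := by
  rw [TwoSidedIdeal.mem_iff, ← RingCon.eq]
  rfl

theorem pathClass_mul (p q : QPath Q) (h : q.tgt = p.src) :
    pathClass k R p * pathClass k R q = pathClass k R (p.comp q h) := by
  rw [pathClass, pathClass, ← map_mul, ← of_comp, pathClass]

theorem pathClass_mul_eq_zero {p q : QPath Q} (h : ¬ q.tgt = p.src) :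
    pathClass k R p * pathClass k R q = 0 := by
  rw [pathClass, pathClass, ← map_mul, of_mul_of_eq_zero k h, map_zero]

/-- The residue map as a linear map. -/
noncomputable def residue : PathAlgebra k Q →ₗ[k] MonomialAlgebra k R :=
  ((monomialIdeal k R).ringCon.mkₐ (α := k)).toLinearMap

theorem residue_of (p : QPath Q) : residue k R (PathAlgebra.of k p) = pathClass k R p := rfl

theorem residue_surjective : Function.Surjective (residue k R) :=
  RingCon.mkₐ_surjective (α := k) _

theorem residue_eq_zero {y : PathAlgebra k Q} : residue k R y = 0 ↔ y ∈ monomialIdeal k R := by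
  rw [TwoSidedIdeal.mem_iff, ← RingCon.eq]
  rfl

/-- A monomial ideal is spanned by the paths in it, so it meets the span of the other paths
trivially. -/
theorem linearIndependent_pathClass :
    LinearIndependent k (fun p : NonzeroPath k R => pathClass k R p) := by
  have h1 : LinearIndependent k (fun p : NonzeroPath k R => pathBasis k Q p) :=
    (pathBasis k Q).linearIndependent.comp _ Subtype.val_injective
  have h2 := h1.map (f := residue k R) (by
    have h3 := (pathBasis k Q).linearIndependent.disjoint_span_image
      (s := {p | PathAlgebra.of k p ∉ monomialIdeal k R})
      (t := {p | PathAlgebra.of k p ∈ monomialIdeal k R})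
      (Set.disjoint_left.2 fun p hp hp' => hp hp')
    rw [Set.image_eq_range] at h3
    refine h3.mono_right (fun y hy => ?_)
    have hy' := (residue_eq_zero k R).1 hy
    rw [show ⇑(pathBasis k Q) = PathAlgebra.of k from funext (pathBasis_apply k)]
    refine mem_span_of_mem_monomialIdeal ?_ ?_ ?_ hy'
    · intro p q h hq
      rw [Set.mem_ofPred_eq, of_comp]
      exact TwoSidedIdeal.mul_mem_left _ _ _ hq
    · intro p q h hp
      rw [Set.mem_ofPred_eq, of_comp]
      exact TwoSidedIdeal.mul_mem_right _ _ _ hp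
    · intro p hp
      exact TwoSidedIdeal.subset_span ⟨p, hp, rfl⟩)
  have h3 : residue k R ∘ (fun p : NonzeroPath k R => pathBasis k Q p) =
      fun p : NonzeroPath k R => pathClass k R p := by
    ext p
    rw [Function.comp_apply, pathBasis_apply, residue_of]
  rw [h3] at h2
  exact h2

/-- The basis of a monomial algebra consisting of the nonzero residue classes of paths. -/
noncomputable def classBasis : Module.Basis (NonzeroPath k R) k (MonomialAlgebra k R) :=
  Module.Basis.mk (linearIndependent_pathClass k R) (by
    intro y hy
    clear hy
    obtain ⟨y, rfl⟩ := residue_surjective k R y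
    induction y using PathAlgebra.induction with
    | h0 => rw [map_zero]; exact Submodule.zero_mem _
    | hadd x y hx hy => rw [map_add]; exact Submodule.add_mem _ hx hy
    | hof c p =>
      rw [map_smul, residue_of]
      refine Submodule.smul_mem _ c ?_
      by_cases hp : PathAlgebra.of k p ∈ monomialIdeal k R
      · rw [(pathClass_eq_zero k R).2 hp]
        exact Submodule.zero_mem _
      · exact Submodule.subset_span ⟨⟨p, hp⟩, rfl⟩)

theorem classBasis_apply (p : NonzeroPath k R) : classBasis k R p = pathClass k R p :=
  Module.Basis.mk_apply _ _ _

theorem range_classBasis : Set.range (classBasis k R) = pathSet k R := by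
  ext y
  constructor
  · rintro ⟨p, rfl⟩
    exact ⟨p, p.2, classBasis_apply k R p⟩
  · rintro ⟨p, hp, rfl⟩
    exact ⟨⟨p, hp⟩, classBasis_apply k R _⟩

theorem classBasis_mul_eq {p q r : NonzeroPath k R} :
    classBasis k R p * classBasis k R q = classBasis k R r ↔ ∃ h, r.1 = p.1.comp q.1 h := by
  rw [classBasis_apply, classBasis_apply, classBasis_apply]
  constructor
  · intro h
    have h0 : pathClass k R r ≠ 0 := fun h0 => r.2 ((pathClass_eq_zero k R).1 h0)
    by_cases hpq : q.1.tgt = p.1.src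
    · rw [pathClass_mul k R _ _ hpq] at h
      have hne : PathAlgebra.of k (p.1.comp q.1 hpq) ∉ monomialIdeal k R := by
        rwa [← pathClass_eq_zero, h]
      have h1 : classBasis k R ⟨_, hne⟩ = classBasis k R r := by
        rw [classBasis_apply, classBasis_apply, h]
      exact ⟨hpq, congrArg Subtype.val ((classBasis k R).injective h1).symm⟩
    · exact absurd ((pathClass_mul_eq_zero k R hpq).symm.trans h).symm h0
  · rintro ⟨h, hr⟩
    rw [pathClass_mul k R _ _ h, hr]

variable {R} in
/-- The structure of a monomial algebra given by its nonzero paths. -/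
noncomputable def monomialBasis (hR : IsAdmissible k R) :
    MonomialBasis k (vertexIdem k R) (NonzeroPath k R) where
  basis := classBasis k R
  src p := p.1.src
  tgt p := p.1.tgt
  len p := p.1.length
  triv i := ⟨QPath.trivial Q i, fun h => absurd (hR.length_of_mem h) (by
    change ¬ 2 ≤ 0
    omega)⟩
  basis_triv i := classBasis_apply k R _
  sum_e := by
    simp only [vertexIdem, pathClass]
    rw [← map_sum, ← PathAlgebra.one_def, map_one]
  src_triv _ := rfl
  tgt_triv _ := rfl
  len_triv _ := rfl
  eq_triv _ hp := Subtype.ext (QPath.eq_trivial hp)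
  e_mul p := by
    rw [classBasis_apply, vertexIdem, pathClass_mul k R _ _ (by rfl), QPath.trivial_comp]
  mul_e p := by
    rw [classBasis_apply, vertexIdem, pathClass_mul k R _ _ (by rfl), QPath.comp_trivial]
  mul_of_ne p q h := by
    rw [classBasis_apply, classBasis_apply, pathClass_mul_eq_zero k R (fun h' => h h'.symm)]
  mul_eq p q := by
    by_cases h : q.1.tgt = p.1.src
    · by_cases h' : PathAlgebra.of k (p.1.comp q.1 h) ∈ monomialIdeal k R
      · left
        rw [classBasis_apply, classBasis_apply, pathClass_mul k R _ _ h, pathClass_eq_zero]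
        exact h'
      · exact Or.inr ⟨⟨_, h'⟩, (classBasis_mul_eq k R).2 ⟨h, rfl⟩⟩
    · left
      rw [classBasis_apply, classBasis_apply, pathClass_mul_eq_zero k R h]
  src_mul h := by
    obtain ⟨_, hr⟩ := (classBasis_mul_eq k R).1 h
    rw [hr]
    rfl
  tgt_mul h := by
    obtain ⟨_, hr⟩ := (classBasis_mul_eq k R).1 h
    rw [hr]
    rfl
  len_mul h := by
    obtain ⟨_, hr⟩ := (classBasis_mul_eq k R).1 h
    rw [hr, QPath.length_comp]
  split r l hl := by
    obtain ⟨q, t, h, hr, ht⟩ := r.1.exists_comp hl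
    have hne := r.2
    rw [hr, of_comp] at hne
    exact ⟨⟨q, fun h' => hne (TwoSidedIdeal.mul_mem_right _ _ _ h')⟩,
      ⟨t, fun h' => hne (TwoSidedIdeal.mul_mem_left _ _ _ h')⟩,
      (classBasis_mul_eq k R).2 ⟨h, hr⟩, ht⟩
  cancel h h' hl := by
    obtain ⟨_, hr⟩ := (classBasis_mul_eq k R).1 h
    obtain ⟨_, hr'⟩ := (classBasis_mul_eq k R).1 h'
    obtain ⟨h1, h2⟩ := QPath.comp_inj hl (hr.symm.trans hr')
    exact ⟨Subtype.ext h1, Subtype.ext h2⟩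

theorem paths_monomialBasis (hR : IsAdmissible k R) :
    (monomialBasis k hR).paths = pathSet k R := range_classBasis k R

theorem finite_nonzeroPath (hQ : ∀ i j, Finite (Q.Hom i j)) (hR : IsAdmissible k R) :
    Finite (NonzeroPath k R) := by
  obtain ⟨N, hN⟩ := hR.2
  exact ((QPath.finite_length_lt hQ N).subset
    (fun p (hp : PathAlgebra.of k p ∉ monomialIdeal k R) =>
      not_le.1 fun h => hp (hN p h))).to_subtype

end Monomial

end MonomialQH

/-! ### The main theorem -/

theorem proposition4p4 {k : Type u} [Field k] {n : ℕ} (Q : Quiver.{v} (Fin n))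
    (hQ : ∀ i j, Finite (Q.Hom i j))
    (R : Set (MonomialQH.QPath Q)) (hR : MonomialQH.IsAdmissible k R)
    (hA : MonomialQH.IsQuasiHereditary (MonomialQH.vertexIdem k R) k) :
    -- exact Borel subalgebras containing the trivial and the right-minimal paths
    (∀ B : Subalgebra k (MonomialQH.MonomialAlgebra k R),
      MonomialQH.IsExactBorel B (MonomialQH.vertexIdem k R) →
      MonomialQH.ContainsRightMinimal (MonomialQH.vertexIdem k R) (MonomialQH.pathSet k R) B →
      B = MonomialQH.Bmin k (MonomialQH.vertexIdem k R) (MonomialQH.pathSet k R)) ∧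
    -- the two conditions on an exact Borel subalgebra are equivalent
    (∀ B : Subalgebra k (MonomialQH.MonomialAlgebra k R),
      MonomialQH.IsExactBorel B (MonomialQH.vertexIdem k R) →
      (MonomialQH.HasPathBasis (MonomialQH.pathSet k R) B ↔
        MonomialQH.ContainsRightMinimal (MonomialQH.vertexIdem k R)
          (MonomialQH.pathSet k R) B)) ∧
    -- `B_min` is the unique exact Borel subalgebra with a basis of paths
    (∀ B : Subalgebra k (MonomialQH.MonomialAlgebra k R),
      (MonomialQH.IsExactBorel B (MonomialQH.vertexIdem k R) ∧
        MonomialQH.HasPathBasis (MonomialQH.pathSet k R) B) ↔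
      B = MonomialQH.Bmin k (MonomialQH.vertexIdem k R) (MonomialQH.pathSet k R)) ∧
    -- `C_minᵒᵖ` is the unique Δ-subalgebra with a basis of paths
    (∀ C : Subalgebra k (MonomialQH.MonomialAlgebra k R),
      (MonomialQH.IsDeltaSubalgebra (MonomialQH.vertexIdem k R) C ∧
        MonomialQH.HasPathBasis (MonomialQH.pathSet k R) C) ↔
      C = MonomialQH.CminOp k (MonomialQH.vertexIdem k R) (MonomialQH.pathSet k R)) := by
  have hfin := MonomialQH.finite_nonzeroPath k R hQ hR
  have hC := (MonomialQH.monomialBasis k hR).noCycle_of_end hA.2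
  have hH := (MonomialQH.monomialBasis k hR).noRelation_of_filtration hC hA.1
  rw [← MonomialQH.paths_monomialBasis k R hR]
  exact ⟨fun B hB h => (MonomialQH.monomialBasis k hR).eq_Bmin_of_containsRightMinimal hC hB h,
    fun B hB => (MonomialQH.monomialBasis k hR).hasPathBasis_iff_containsRightMinimal hC hB,
    (MonomialQH.monomialBasis k hR).isExactBorel_and_hasPathBasis_iff hC hH,
    (MonomialQH.monomialBasis k hR).isDeltaSubalgebra_and_hasPathBasis_iff hC hH⟩
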